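/- Let $\mathbb T$ be the unit circle with normalized arclength measure $\mu$, let $\chi(z)=z$, and let $H^2\subset L^2(\mathbb T)$ be the Hardy space, whose elements are identified with their analytic extensions to the unit disc $\mathbb D$. A function $f\in H^2$ is called outer if its polynomial multiples are dense in $H^2$. For a subspace $\mathcal V\subset \mathbb C\oplus\mathbb C z$ put $H^2_{\mathcal V}=H^2\ominus\mathcal V$, and for a real-valued $\phi\in L^\infty(\mathbb T)$ let $T^{\mathcal V}_\phi f=P_{\mathcal V}(\phi f)$ on $H^2_{\mathcal V}$, where $P_{\mathcal V}$ is the orthogonal projection of $L^2(\mathbb T)$ onto $H^2_{\mathcal V}$. Let $\phi\in L^\infty(\mathbb T)$ be real-valued and let $c\in\mathbb C\setminus\{0\}$ be such that $$\operatorname{ess\,sup}\{\phi(z): cz+\overline{cz}<0\}=m<0<M=\operatorname{ess\,inf}\{\phi(z): cz+\overline{cz}>0\}.$$ Let $\lambda\in(m,M)$ and, for $z\in\mathbb D$ and $t\in\mathbb R$, put $H(z,t)=\frac{e^{it}+z}{e^{it}-z}$, $$h_c(z)=\exp\Bigl(\frac1{2\pi}\int_{-\pi}^{\pi}H(z,t)\log|ce^{it}+\bar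 c e^{-it}|^{1/2}\,dt\Bigr),\qquad g_\lambda(z)=\exp\Bigl(\frac1{2\pi}\int_{-\pi}^{\pi}H(z,t)\log|\phi(e^{it})-\lambda|^{-1/2}\,dt\Bigr).$$ Then: 1. $h_c$ and $g_\lambda$ are outer functions in $H^2$, and $h_c(0)\neq0$, $g_\lambda(0)\neq 0$. 2. There is an outer function $f_\lambda\in H^2$ with $(\phi-\lambda)|f_\lambda|^2=c\chi+\overline{c\chi}$ a.e. on $\mathbb T$ and $f_\lambda=h_c\,g_\lambda$ on $\mathbb D$; every outer function satisfying the same equation on $\mathbb T$ is a unimodular constant multiple of $f_\lambda$. 3. There is a subspace $\mathcal V\subset\mathbb C\oplus\mathbb C z$, with $\mathcal V\ne\{0\}$ and $\mathcal V\neq\mathbb C\oplus\mathbb C z$, orthogonal to $$h_c(0)g_\lambda(0)+\bigl(h_c(0)g_\lambda'(0)+h_c'(0)g_\lambda(0)\bigr)z,$$ such that $f_\lambda\in H^2_{\mathcal V}$ and $T^{\mathcal V}_\phi f_\lambda=\lambda f_\lambda$. It is the only nonzero subspace $\mathcal W\subset\mathbb C\oplus\mathbb C z$ with $f_\lambda\in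 H^2_{\mathcal W}$. Moreover, if $\mathcal W\subset\mathbb C\oplus\mathbb C z$ is any subspace and $f\in H^2_{\mathcal W}$ is nonzero with $T^{\mathcal W}_\phi f=\lambda f$, then $\mathcal W=\mathcal V$ and $f$ is a nonzero scalar multiple of $f_\lambda$. -/

import Mathlib

open MeasureTheory AddCircle
open scoped ENNReal

noncomputable section

namespace NeilToeplitz

instance fact_two_pi_pos : Fact (0 < 2 * Real.pi) := ⟨Real.two_pi_pos⟩

/-- The unit circle, parametrised by the angle `t` modulo `2π`. The coordinate function
`χ(e^{it}) = e^{it}` is `fourier 1`. -/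
abbrev Torus : Type := AddCircle (2 * Real.pi)

/-- Normalised arclength measure on the unit circle. -/
abbrev arc : Measure Torus := haarAddCircle

/-- `L²` of the circle with respect to normalised arclength. -/
abbrev L2 : Type := Lp ℂ 2 arc

/-- The Hardy space `H²`, as the space of boundary functions: those `f ∈ L²` whose Fourier
coefficients of negative index vanish. -/
def H2 : Submodule ℂ L2 where
  carrier := {f | ∀ n : ℤ, n < 0 → fourierCoeff f n = 0}
  add_mem' := by
    intro f g hf hg n hn
    have hf' := hf n hn
    have hg' := hg n hn
    rw [← fourierBasis_repr] at hf' hg' ⊢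
    simp [hf', hg']
  zero_mem' := by
    intro n _
    rw [← fourierBasis_repr]
    simp
  smul_mem' := by
    intro a f hf n hn
    have hf' := hf n hn
    rw [← fourierBasis_repr] at hf' ⊢
    simp [hf']

theorem mem_H2 (f : L2) : f ∈ H2 ↔ ∀ n : ℤ, n < 0 → fourierCoeff f n = 0 := Iff.rfl

theorem isClosed_H2 : IsClosed (H2 : Set L2) := by
  have h : (H2 : Set L2) =
      ⋂ (n : ℤ) (_ : n < 0), {f : L2 | inner ℂ (fourierBasis n : L2) f = 0} := by
    ext f
    simp only [SetLike.mem_coe, mem_H2, Set.mem_iInter, Set.mem_ofPred_eq,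
      ← HilbertBasis.repr_apply_apply, fourierBasis_repr]
  rw [h]
  refine isClosed_iInter fun n => isClosed_iInter fun _ => ?_
  exact isClosed_eq (continuous_const.inner continuous_id) continuous_const

/-- The value at a point `z` of the unit disc of the analytic function with boundary function
`f ∈ H²`, i.e. `∑ n ≥ 0, f^(n) z ^ n`. -/
def eval (f : L2) (z : ℂ) : ℂ := ∑' n : ℕ, fourierCoeff f (n : ℤ) * z ^ n

/-- Multiplication by a (class of a) bounded function, as a bounded operator on `L²`. -/
def mulL (u : Lp ℂ ∞ arc) : L2 →L[ℂ] L2 :=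
  (ContinuousLinearMap.mul ℂ ℂ).holderL arc ∞ 2 2 u

/-- `f` is an outer function in `H²`: the polynomial multiples of `f` are dense in `H²`. -/
def IsOuter (f : L2) : Prop :=
  (Submodule.span ℂ (Set.range fun n : ℕ => mulL (fourierLp ∞ (n : ℤ)) f)).topologicalClosure = H2

/-- A function on the disc is outer (in `H²`) if it is the analytic extension of an outer
`f ∈ H²`. -/
def IsOuterOnDisc (F : ℂ → ℂ) : Prop :=
  ∃ f : L2, IsOuter f ∧ ∀ z ∈ Metric.ball (0 : ℂ) 1, F z = eval f z

/-- The constant function `1` in `L²`. -/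
def one : L2 := fourierLp 2 0

/-- The coordinate function `χ(z) = z` in `L²`. -/
def chi : L2 := fourierLp 2 1

/-- The two-dimensional space `ℂ ⊕ ℂ z`. -/
def linPoly : Submodule ℂ L2 := Submodule.span ℂ {one, chi}

/-- `H²_𝒱 = H² ⊖ 𝒱`. -/
def H2V (V : Submodule ℂ L2) : Submodule ℂ L2 := H2 ⊓ Vᗮ

instance completeSpace_H2V (V : Submodule ℂ L2) : CompleteSpace (H2V V) := by
  have h : IsClosed (H2V V : Set L2) := by
    have := isClosed_H2.inter V.isClosed_orthogonal
    simpa [H2V] using this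
  exact h.completeSpace_coe

/-- The Toeplitz operator `T_φ^𝒱 f = P_𝒱 (φ f)` on `H²_𝒱`, for a real symbol `φ ∈ L^∞`;
`P_𝒱` is the orthogonal projection of `L²` onto `H²_𝒱`. -/
def toeplitz (φ : Torus → ℝ) (hφ : MemLp φ ∞ arc) (V : Submodule ℂ L2) :
    H2V V →L[ℂ] H2V V :=
  (H2V V).orthogonalProjectionOnto ∘L
    mulL (MemLp.toLp (fun t => (φ t : ℂ)) hφ.ofReal) ∘L (H2V V).subtypeL

/-- The real-valued function `cχ + (cχ)^* = 2 Re (cχ)` on the circle. -/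
def trig (c : ℂ) (t : Torus) : ℝ := 2 * (c * fourier 1 t).re

/-- The Herglotz kernel `H(z,t) = (e^{it} + z) / (e^{it} - z)`. -/
def herglotz (z : ℂ) (t : ℝ) : ℂ :=
  (Complex.exp (Complex.I * t) + z) / (Complex.exp (Complex.I * t) - z)

/-- `h_c(z) = exp ((1/2π) ∫_{-π}^{π} H(z,t) log |c e^{it} + c^* e^{-it}|^{1/2} dt)`. -/
def hFun (c : ℂ) (z : ℂ) : ℂ :=
  Complex.exp ((1 / (2 * Real.pi) : ℂ) * ∫ t in (-Real.pi)..Real.pi, herglotz z t *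
    (Real.log (‖c * Complex.exp (Complex.I * t) +
      (starRingEnd ℂ) c * Complex.exp (-(Complex.I * t))‖ ^ (1 / 2 : ℝ)) : ℂ))

/-- `g_l(z) = exp ((1/2π) ∫_{-π}^{π} H(z,t) log |φ(t) - l|^{-1/2} dt)`. -/
def gFun (φ : Torus → ℝ) (l : ℝ) (z : ℂ) : ℂ :=
  Complex.exp ((1 / (2 * Real.pi) : ℂ) * ∫ t in (-Real.pi)..Real.pi, herglotz z t *
    (Real.log (|φ (t : Torus) - l| ^ (-1 / 2 : ℝ)) : ℂ))

end NeilToeplitz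

end

/-!
Put `ψ = φ - l`. It has the same sign as `cχ + (cχ)^*` and is bounded away from `0` and `∞`, so
that `f = exp(A)`, with `A` the analytic completion of `log |cχ + (cχ)^*|^{1/2} - log |ψ|^{1/2}`, is
outer and solves `ψ |f|² = cχ + (cχ)^*`. Its companion `χ (ψ f)^*` is outer too: the product of `f`
and its companion is `χ (cχ + (cχ)^*) = c z² + c^*`, which has no zeros in the open disc, and hence
is a constant times the exponential of the analytic completion of its log-modulus.

A function `g ∈ H²_𝒲` is an eigenvector for `l` exactly when `ψ g ⊥ H²_𝒲`. Testing this against `g`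
and `z^n g`, `n ≥ 2`, shows that only the coefficients of index `±1` of `ψ |g|²` survive, so
`ψ |g|² = dχ + (dχ)^*`; comparing signs, `d` is a nonnegative multiple of `c`, and `|g|` is a
constant multiple of `|f|`. Testing against `z^n`, `n ≥ 2`, shows that the companion of `g` lies in
`H²`. So `u = g / f` is bounded and both `u f` and `u^* χ (ψ f)^*` lie in `H²`. As `f` and its
companion are outer, `u` and `u^*` lie in `H²`, and `u` is constant.
-/

noncomputable section

namespace NeilToeplitz

open Filter Topology ComplexConjugate

section FourierCoefficients

theorem fourierCoeff_eq_inner (f : L2) (n : ℤ) :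
    fourierCoeff f n = inner ℂ (fourierLp 2 n : L2) f := by
  rw [← fourierBasis_repr, HilbertBasis.repr_apply_apply, coe_fourierBasis]

theorem ext_fourierCoeff {f g : L2} (h : ∀ n, fourierCoeff f n = fourierCoeff g n) : f = g := by
  apply fourierBasis.repr.injective
  ext n
  simpa only [fourierBasis_repr] using h n

theorem fourierCoeff_zero (n : ℤ) : fourierCoeff (0 : L2) n = 0 := by
  rw [fourierCoeff_eq_inner, inner_zero_right]

theorem fourierCoeff_add (f g : L2) (n : ℤ) :
    fourierCoeff (f + g : L2) n = fourierCoeff f n + fourierCoeff g n := by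
  simp only [fourierCoeff_eq_inner, inner_add_right]

theorem fourierCoeff_sub (f g : L2) (n : ℤ) :
    fourierCoeff (f - g : L2) n = fourierCoeff f n - fourierCoeff g n := by
  simp only [fourierCoeff_eq_inner, inner_sub_right]

theorem fourierCoeff_smul (a : ℂ) (f : L2) (n : ℤ) :
    fourierCoeff (a • f : L2) n = a * fourierCoeff f n := by
  simp only [fourierCoeff_eq_inner, inner_smul_right]

theorem fourierCoeff_fourierLp (k n : ℤ) :
    fourierCoeff (fourierLp 2 k : L2) n = if n = k then 1 else 0 := by
  rw [fourierCoeff_eq_inner]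
  exact orthonormal_iff_ite.1 orthonormal_fourier n k

theorem fourierCoeff_star (f : L2) (n : ℤ) :
    fourierCoeff (star f : L2) n = conj (fourierCoeff f (-n)) := by
  rw [fourierCoeff_congr_ae (Lp.coeFn_star f)]
  unfold fourierCoeff
  rw [← integral_conj]
  simp

end FourierCoefficients

section Multiplication

theorem coeFn_mulL (u : Lp ℂ ∞ arc) (f : L2) : mulL u f =ᵐ[arc] fun t => u t * f t :=
  (ContinuousLinearMap.mul ℂ ℂ).coeFn_holder (r := 2) u f

/-- Multiplication of `L²` functions by continuous functions, as a bounded bilinear map. -/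
def mulC : C(Torus, ℂ) →L[ℂ] L2 →L[ℂ] L2 :=
  (ContinuousLinearMap.mul ℂ ℂ).holderL arc ∞ 2 2 ∘L ContinuousMap.toLp ∞ arc ℂ

theorem coeFn_mulC (u : C(Torus, ℂ)) (f : L2) : mulC u f =ᵐ[arc] fun t => u t * f t := by
  filter_upwards [coeFn_mulL (ContinuousMap.toLp ∞ arc ℂ u) f,
    ContinuousMap.coeFn_toLp (p := ∞) (𝕜 := ℂ) arc u] with t h₁ h₂
  rw [← h₂]
  exact h₁

theorem mulC_mul (u v : C(Torus, ℂ)) (f : L2) : mulC (u * v) f = mulC u (mulC v f) := by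
  apply Lp.ext
  filter_upwards [coeFn_mulC (u * v) f, coeFn_mulC u (mulC v f), coeFn_mulC v f] with t h₁ h₂ h₃
  rw [h₁, h₂, h₃, ContinuousMap.mul_apply, mul_assoc]

theorem mulC_one (f : L2) : mulC 1 f = f := by
  apply Lp.ext
  filter_upwards [coeFn_mulC 1 f] with t h
  rw [h, ContinuousMap.one_apply, one_mul]

theorem mulL_mulC_comm (u : Lp ℂ ∞ arc) (v : C(Torus, ℂ)) (f : L2) :
    mulL u (mulC v f) = mulC v (mulL u f) := by
  apply Lp.ext
  filter_upwards [coeFn_mulL u (mulC v f), coeFn_mulC v (mulL u f), coeFn_mulL u f,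
    coeFn_mulC v f] with t h₁ h₂ h₃ h₄
  rw [h₁, h₂, h₃, h₄, mul_left_comm]

theorem fourier_mul (m n : ℤ) :
    (fourier m * fourier n : C(Torus, ℂ)) = fourier (m + n) := by
  ext t
  rw [ContinuousMap.mul_apply, fourier_add]

theorem norm_fourier_apply (n : ℤ) (t : Torus) : ‖fourier n t‖ = 1 := by
  rw [fourier_apply, Circle.norm_coe]

theorem fourierCoeff_mulC_fourier (k : ℤ) (f : L2) (n : ℤ) :
    fourierCoeff (mulC (fourier k) f) n = fourierCoeff f (n - k) := by
  rw [fourierCoeff_congr_ae (coeFn_mulC (fourier k) f)]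
  unfold fourierCoeff
  congr 1 with t
  rw [smul_eq_mul, smul_eq_mul, ← mul_assoc, ← fourier_add, neg_add_eq_sub, neg_sub]

theorem mulC_fourier_one (n : ℤ) : mulC (fourier n) one = (fourierLp 2 n : L2) :=
  ext_fourierCoeff fun k => by
    rw [fourierCoeff_mulC_fourier, one, fourierCoeff_fourierLp, fourierCoeff_fourierLp]
    simp only [sub_eq_zero]

theorem coeFn_one : (one : Torus → ℂ) =ᵐ[arc] fun _ => 1 := by
  filter_upwards [coeFn_fourierLp (T := 2 * Real.pi) 2 0] with t h
  rw [one, h, fourier_zero]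

end Multiplication

section HardySpace

instance completeSpace_H2 : CompleteSpace H2 := isClosed_H2.completeSpace_coe

theorem fourierLp_mem_H2 (n : ℕ) : (fourierLp 2 (n : ℤ) : L2) ∈ H2 := by
  intro k hk
  rw [fourierCoeff_fourierLp, if_neg (by lia)]

theorem one_mem_H2 : one ∈ H2 := fourierLp_mem_H2 0

theorem mulC_fourier_mem_H2 (n : ℕ) {f : L2} (hf : f ∈ H2) : mulC (fourier n) f ∈ H2 := by
  intro k hk
  rw [fourierCoeff_mulC_fourier]
  exact hf _ (by lia)

/-- The Szegő kernel: it reproduces the values of `f ∈ H²` at the point `z` of the disc. -/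
def szego (z : ℂ) : L2 := ∑' n : ℕ, conj z ^ n • (fourierLp 2 (n : ℤ) : L2)

theorem hasSum_inner_szego (f : L2) {z : ℂ} (hz : ‖z‖ < 1) :
    HasSum (fun n : ℕ => fourierCoeff f n * z ^ n) (inner ℂ (szego z) f) := by
  have hsum : Summable fun n : ℕ => conj z ^ n • (fourierLp 2 (n : ℤ) : L2) := by
    refine .of_norm ((summable_geometric_of_lt_one (norm_nonneg z) hz).congr fun n => ?_)
    rw [norm_smul, orthonormal_fourier.1, norm_pow, RCLike.norm_conj, mul_one]
  have h := Complex.hasSum_conj'.2 (hsum.hasSum.mapL (innerSL ℂ f))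
  simp only [innerSL_apply_apply, inner_conj_symm] at h
  refine h.congr_fun fun n => ?_
  rw [inner_smul_left, ← fourierCoeff_eq_inner, map_pow, Complex.conj_conj, mul_comm]

theorem eval_eq_inner (f : L2) {z : ℂ} (hz : ‖z‖ < 1) : eval f z = inner ℂ (szego z) f :=
  (hasSum_inner_szego f hz).tsum_eq

theorem hasSum_eval (f : L2) {z : ℂ} (hz : ‖z‖ < 1) :
    HasSum (fun n : ℕ => fourierCoeff f n * z ^ n) (eval f z) :=
  eval_eq_inner f hz ▸ hasSum_inner_szego f hz

theorem continuous_eval {z : ℂ} (hz : ‖z‖ < 1) : Continuous fun f : L2 => eval f z := by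
  simp only [eval_eq_inner _ hz]
  exact continuous_const.inner continuous_id

theorem eval_add (f g : L2) {z : ℂ} (hz : ‖z‖ < 1) : eval (f + g) z = eval f z + eval g z := by
  simp only [eval_eq_inner _ hz, inner_add_right]

theorem eval_smul (a : ℂ) (f : L2) {z : ℂ} (hz : ‖z‖ < 1) :
    eval (a • f) z = a * eval f z := by
  simp only [eval_eq_inner _ hz, inner_smul_right]

theorem eval_mulC_fourier_one (f : L2) {z : ℂ} (hz : ‖z‖ < 1) :
    eval (mulC (fourier 1) f) z = fourierCoeff f (-1) + z * eval f z := by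
  have hsum := hasSum_eval (mulC (fourier 1) f) hz
  simp only [fourierCoeff_mulC_fourier] at hsum
  have htail : HasSum (fun n : ℕ => fourierCoeff f ((n + 1 : ℕ) - 1 : ℤ) * z ^ (n + 1))
      (z * eval f z) := by
    refine ((hasSum_eval f hz).mul_left z).congr_fun fun n => ?_
    rw [Nat.cast_succ, add_sub_cancel_right]
    ring
  rw [hsum.unique (HasSum.zero_add (f := fun n : ℕ => fourierCoeff f (n - 1 : ℤ) * z ^ n) htail)]
  simp only [Nat.cast_zero, zero_sub, pow_zero, mul_one]

theorem eval_zero (f : L2) : eval f 0 = fourierCoeff f 0 := by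
  refine (hasSum_eval f (by simp)).unique ?_
  simpa using hasSum_single (f := fun n : ℕ => fourierCoeff f n * (0 : ℂ) ^ n) 0
    fun n hn => by simp [hn]

theorem norm_fourierCoeff_le (f : L2) (n : ℤ) : ‖fourierCoeff f n‖ ≤ ‖f‖ := by
  rw [fourierCoeff_eq_inner]
  simpa [orthonormal_fourier.1 n] using norm_inner_le_norm (𝕜 := ℂ) (fourierLp 2 n : L2) f

theorem hasDerivAt_eval_zero (f : L2) : HasDerivAt (eval f) (fourierCoeff f 1) 0 := by
  have hsum : Summable fun n : ℕ => ‖f‖ * (1 / 2 : ℝ) ^ n := summable_geometric_two.mul_left _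
  have hdiff (n : ℕ) :
      DifferentiableOn ℂ (fun w => fourierCoeff f n * w ^ n) (Metric.ball 0 (1 / 2)) := by
    fun_prop
  have hbound (n : ℕ) (w : ℂ) (hw : w ∈ Metric.ball 0 (1 / 2)) :
      ‖fourierCoeff f n * w ^ n‖ ≤ ‖f‖ * (1 / 2) ^ n := by
    rw [norm_mul, norm_pow]
    gcongr
    · exact norm_fourierCoeff_le f n
    · exact (mem_ball_zero_iff.1 hw).le
  have hmem : (0 : ℂ) ∈ Metric.ball 0 (1 / 2) := Metric.mem_ball_self (by norm_num)
  have hderiv : deriv (eval f) 0 = fourierCoeff f 1 := by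
    refine (Complex.hasSum_deriv_of_summable_norm hsum hdiff Metric.isOpen_ball hbound
      hmem).unique ?_
    have hterm (n : ℕ) (hn : n ≠ 1) :
        deriv (fun w => fourierCoeff f n * w ^ n) (0 : ℂ) = 0 := by
      rcases n with _ | _ | n <;> simp_all
    simpa using hasSum_single 1 hterm
  rw [← hderiv]
  exact ((Complex.differentiableOn_tsum_of_summable_norm hsum hdiff Metric.isOpen_ball
    hbound).differentiableAt (Metric.isOpen_ball.mem_nhds hmem)).hasDerivAt

end HardySpace

section DiscAlgebra

/-- The disc algebra, as the closed algebra of continuous functions on the circle generated by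
the coordinate function. -/
abbrev discAlgebra : Subalgebra ℂ C(Torus, ℂ) := Algebra.elemental ℂ (fourier 1)

theorem fourier_natCast (n : ℕ) : (fourier n : C(Torus, ℂ)) = fourier 1 ^ n := by
  ext t
  simp [fourier_apply, toCircle_nsmul]

theorem fourier_natCast_mem_discAlgebra (n : ℕ) : fourier n ∈ discAlgebra :=
  fourier_natCast n ▸ pow_mem (Algebra.elemental.self_mem ℂ _) n

theorem continuous_mulC_apply (f : L2) : Continuous fun u : C(Torus, ℂ) => mulC u f :=
  mulC.continuous.clm_apply continuous_const

theorem mulC_algebraMap (a : ℂ) (f : L2) : mulC (algebraMap ℂ C(Torus, ℂ) a) f = a • f := by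
  rw [Algebra.algebraMap_eq_smul_one, map_smul, smul_apply, mulC_one]

theorem mulC_mem_of_mem_discAlgebra {K : Submodule ℂ L2} (hK : IsClosed (K : Set L2))
    (hshift : ∀ f ∈ K, mulC (fourier 1) f ∈ K) {u : C(Torus, ℂ)} (hu : u ∈ discAlgebra)
    {f : L2} (hf : f ∈ K) : mulC u f ∈ K := by
  let S : Subalgebra ℂ C(Torus, ℂ) :=
    { carrier := {u | ∀ f ∈ K, mulC u f ∈ K}
      algebraMap_mem' := fun a f hf => mulC_algebraMap a f ▸ K.smul_mem a hf
      add_mem' := fun hu hv f hf => by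
        rw [map_add, add_apply]
        exact K.add_mem (hu f hf) (hv f hf)
      mul_mem' := fun hu hv f hf => mulC_mul _ _ f ▸ hu _ (hv f hf) }
  have hS : IsClosed (S : Set C(Torus, ℂ)) := by
    change IsClosed {u : C(Torus, ℂ) | ∀ f ∈ K, mulC u f ∈ K}
    simp only [Set.ofPred_forall]
    exact isClosed_biInter fun f _ => hK.preimage (continuous_mulC_apply f)
  exact Algebra.elemental.le_of_mem hS hshift hu f hf

theorem mulC_mem_H2 {u : C(Torus, ℂ)} (hu : u ∈ discAlgebra) {f : L2} (hf : f ∈ H2) :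
    mulC u f ∈ H2 :=
  mulC_mem_of_mem_discAlgebra isClosed_H2 (fun _ h => mulC_fourier_mem_H2 1 h) hu hf

theorem eval_one {z : ℂ} (hz : ‖z‖ < 1) : eval one z = 1 := by
  refine (hasSum_eval one hz).unique ?_
  convert hasSum_ite_eq (0 : ℕ) (1 : ℂ) using 2 with n
  rw [one, fourierCoeff_fourierLp]
  rcases eq_or_ne n 0 with rfl | hn
  · simp
  · simp [hn]

theorem eval_mulC_fourier_one_of_mem_H2 {f : L2} (hf : f ∈ H2) {z : ℂ} (hz : ‖z‖ < 1) :
    eval (mulC (fourier 1) f) z = z * eval f z := by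
  rw [eval_mulC_fourier_one f hz, hf (-1) (by norm_num), zero_add]

theorem eval_mulC {u : C(Torus, ℂ)} (hu : u ∈ discAlgebra) {f : L2} (hf : f ∈ H2) {z : ℂ}
    (hz : ‖z‖ < 1) : eval (mulC u f) z = eval (mulC u one) z * eval f z := by
  let S : Subalgebra ℂ C(Torus, ℂ) :=
    { carrier := {u | ∀ f ∈ H2, mulC u f ∈ H2 ∧
        eval (mulC u f) z = eval (mulC u one) z * eval f z}
      algebraMap_mem' := fun a f hf => by
        simp only [mulC_algebraMap, eval_smul _ _ hz, eval_one hz, mul_one, and_true]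
        exact H2.smul_mem a hf
      add_mem' := fun hu hv f hf => by
        simp only [map_add, add_apply, eval_add _ _ hz, (hu f hf).2,
          (hv f hf).2, add_mul, and_true]
        exact H2.add_mem (hu f hf).1 (hv f hf).1
      mul_mem' := fun hu hv f hf => by
        simp only [mulC_mul]
        have hvf := hv f hf
        have hv1 := hv one one_mem_H2
        refine ⟨(hu _ hvf.1).1, ?_⟩
        rw [(hu _ hvf.1).2, (hu _ hv1.1).2, hvf.2, mul_assoc] }
  have heval (f : L2) : Continuous fun u : C(Torus, ℂ) => eval (mulC u f) z :=
    (continuous_eval hz).comp (continuous_mulC_apply f)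
  have hS : IsClosed (S : Set C(Torus, ℂ)) := by
    change IsClosed {u : C(Torus, ℂ) | ∀ f ∈ H2, mulC u f ∈ H2 ∧
      eval (mulC u f) z = eval (mulC u one) z * eval f z}
    simp only [Set.ofPred_forall, Set.ofPred_and]
    exact isClosed_biInter fun f _ => (isClosed_H2.preimage (continuous_mulC_apply f)).inter
      (isClosed_eq (heval f) ((heval one).mul continuous_const))
  refine (Algebra.elemental.le_of_mem hS (fun f hf => ⟨mulC_fourier_mem_H2 1 hf, ?_⟩) hu f hf).2
  rw [Nat.cast_one, eval_mulC_fourier_one_of_mem_H2 hf hz,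
    eval_mulC_fourier_one_of_mem_H2 one_mem_H2 hz, eval_one hz, mul_one]

theorem exp_mem_discAlgebra {a : C(Torus, ℂ)} (ha : a ∈ discAlgebra) :
    NormedSpace.exp a ∈ discAlgebra :=
  NormedSpace.exp_mem (R := ℂ) (Algebra.elemental.isClosed ℂ _) ha

theorem continuousMap_exp_apply (a : C(Torus, ℂ)) (t : Torus) :
    NormedSpace.exp a t = Complex.exp (a t) := by
  rw [Complex.exp_eq_exp_ℂ]
  exact NormedSpace.map_exp (ContinuousMap.evalAlgHom ℂ ℂ t)
    (continuous_eval_const t) a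

theorem eval_mulC_exp {a : C(Torus, ℂ)} (ha : a ∈ discAlgebra) {f : L2} (hf : f ∈ H2) {z : ℂ}
    (hz : ‖z‖ < 1) :
    eval (mulC (NormedSpace.exp a) f) z = Complex.exp (eval (mulC a one) z) * eval f z := by
  have hpow (n : ℕ) : eval (mulC (a ^ n) f) z = eval (mulC a one) z ^ n * eval f z := by
    induction n with
    | zero => rw [pow_zero, pow_zero, mulC_one, one_mul]
    | succ n ih =>
      rw [pow_succ', mulC_mul, eval_mulC ha (mulC_mem_H2 (pow_mem ha n) hf) hz, ih, pow_succ',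
        mul_assoc]
  obtain ⟨L, hL⟩ : ∃ L : C(Torus, ℂ) →L[ℂ] ℂ, ∀ u, L u = eval (mulC u f) z :=
    ⟨innerSL ℂ (szego z) ∘L mulC.flip f, fun u => (eval_eq_inner _ hz).symm⟩
  have hsum : HasSum (fun n : ℕ => ((n.factorial : ℂ)⁻¹ • eval (mulC a one) z ^ n) * eval f z)
      (L (NormedSpace.exp a)) := by
    refine ((NormedSpace.exp_series_hasSum_exp' (𝕂 := ℂ) a).mapL L).congr_fun fun n => ?_
    rw [map_smul, hL, hpow, smul_mul_assoc]
  rw [← hL, Complex.exp_eq_exp_ℂ]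
  have hexp := NormedSpace.exp_series_hasSum_exp' (𝕂 := ℂ) (eval (mulC a one) z)
  exact hsum.unique (hexp.mul_right (eval f z))

end DiscAlgebra

section OuterFunctions

/-- The closed shift-invariant subspace generated by `f`. -/
def cyclic (f : L2) : Submodule ℂ L2 :=
  (Submodule.span ℂ (Set.range fun n : ℕ => mulC (fourier n) f)).topologicalClosure

theorem isClosed_cyclic (f : L2) : IsClosed (cyclic f : Set L2) :=
  Submodule.isClosed_topologicalClosure _

theorem mulC_fourier_mem_cyclic (f : L2) (n : ℕ) : mulC (fourier n) f ∈ cyclic f :=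
  Submodule.le_topologicalClosure _ (Submodule.subset_span ⟨n, rfl⟩)

theorem mem_cyclic_self (f : L2) : f ∈ cyclic f := by
  simpa only [fourier_natCast, pow_zero, mulC_one] using mulC_fourier_mem_cyclic f 0

theorem map_mem_of_mem_cyclic {f : L2} {K : Submodule ℂ L2} (hK : IsClosed (K : Set L2))
    (Θ : L2 →L[ℂ] L2) (h : ∀ n : ℕ, Θ (mulC (fourier n) f) ∈ K) {g : L2} (hg : g ∈ cyclic f) :
    Θ g ∈ K := by
  have hle : cyclic f ≤ K.comap (Θ : L2 →ₗ[ℂ] L2) := by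
    refine Submodule.topologicalClosure_minimal _ ?_ (hK.preimage Θ.continuous)
    rw [Submodule.span_le]
    rintro _ ⟨n, rfl⟩
    exact h n
  exact hle hg

theorem mulC_mem_cyclic {u : C(Torus, ℂ)} (hu : u ∈ discAlgebra) {f g : L2} (hg : g ∈ cyclic f) :
    mulC u g ∈ cyclic f := by
  refine mulC_mem_of_mem_discAlgebra (isClosed_cyclic f) (fun g hg => ?_) hu hg
  refine map_mem_of_mem_cyclic (isClosed_cyclic f) _ (fun n => ?_) hg
  rw [← mulC_mul, fourier_mul]
  exact_mod_cast mulC_fourier_mem_cyclic f (1 + n)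

theorem cyclic_le_cyclic {f g : L2} (h : g ∈ cyclic f) : cyclic g ≤ cyclic f := fun _ =>
  map_mem_of_mem_cyclic (isClosed_cyclic f) (.id ℂ L2) fun n =>
    mulC_mem_cyclic (fourier_natCast_mem_discAlgebra n) h

theorem cyclic_le_H2 {f : L2} (hf : f ∈ H2) : cyclic f ≤ H2 := fun _ =>
  map_mem_of_mem_cyclic isClosed_H2 (.id ℂ L2) fun n => mulC_fourier_mem_H2 n hf

theorem isOuter_one : IsOuter one := by
  refine le_antisymm (cyclic_le_H2 one_mem_H2) fun f hf => ?_
  refine (isClosed_cyclic one).mem_of_tendsto (hasSum_fourier_series_L2 f)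
    (.of_forall fun s => Submodule.sum_mem _ fun n _ => ?_)
  rcases lt_or_ge n 0 with hn | hn
  · rw [hf n hn, zero_smul]
    exact Submodule.zero_mem _
  · lift n to ℕ using hn
    rw [← mulC_fourier_one]
    exact Submodule.smul_mem _ _ (mulC_fourier_mem_cyclic one n)

theorem IsOuter.mem_H2 {f : L2} (hf : IsOuter f) : f ∈ H2 := hf ▸ mem_cyclic_self f

theorem isOuter_of_one_mem_cyclic {f : L2} (hf : f ∈ H2) (h : one ∈ cyclic f) : IsOuter f :=
  le_antisymm (cyclic_le_H2 hf) (isOuter_one.ge.trans (cyclic_le_cyclic h))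

theorem IsOuter.smul {f : L2} (hf : IsOuter f) {a : ℂ} (ha : a ≠ 0) : IsOuter (a • f) := by
  refine isOuter_of_one_mem_cyclic (H2.smul_mem a hf.mem_H2) ?_
  have hmem : f ∈ cyclic (a • f) := by
    simpa only [inv_smul_smul₀ ha] using Submodule.smul_mem _ a⁻¹ (mem_cyclic_self (a • f))
  exact cyclic_le_cyclic hmem (hf.ge one_mem_H2)

end OuterFunctions

section AnalyticCompletion

/-- The operator `f ↦ 2 P f - ⟨1, f⟩`, with `P` the Riesz projection onto `H²`. It maps `f` to the
boundary function of the Herglotz integral of `f`. -/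
def herglotzOp : L2 →L[ℂ] L2 :=
  (2 : ℂ) • H2.starProjection - (innerSL ℂ one).smulRight one

theorem herglotzOp_apply (f : L2) :
    herglotzOp f = (2 : ℂ) • H2.starProjection f - fourierCoeff f 0 • one := by
  rw [fourierCoeff_eq_inner]
  rfl

theorem herglotzOp_mem_H2 (f : L2) : herglotzOp f ∈ H2 := by
  rw [herglotzOp_apply]
  exact H2.sub_mem (H2.smul_mem _ (Submodule.starProjection_apply_mem _ _))
    (H2.smul_mem _ one_mem_H2)

theorem fourierCoeff_starProjection_H2 (f : L2) (n : ℕ) :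
    fourierCoeff (H2.starProjection f) n = fourierCoeff f n := by
  rw [fourierCoeff_eq_inner, fourierCoeff_eq_inner, ← Submodule.inner_starProjection_left_eq_right,
    Submodule.starProjection_eq_self_iff.2 (fourierLp_mem_H2 n)]

theorem fourierCoeff_herglotzOp (f : L2) (n : ℤ) :
    fourierCoeff (herglotzOp f) n = (1 + n.sign) * fourierCoeff f n := by
  rcases lt_or_ge n 0 with hn | hn
  · rw [herglotzOp_mem_H2 f n hn, Int.sign_eq_neg_one_of_neg hn]
    simp
  · lift n to ℕ using hn
    rw [herglotzOp_apply, fourierCoeff_sub, fourierCoeff_smul, fourierCoeff_smul,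
      fourierCoeff_starProjection_H2, one, fourierCoeff_fourierLp]
    rcases n.eq_zero_or_pos with rfl | hn
    · norm_num
      ring
    · rw [Int.sign_eq_one_of_pos (by exact_mod_cast hn), if_neg (by lia)]
      norm_num

theorem fourier_one_sub_ne_zero {z : ℂ} (hz : ‖z‖ < 1) (t : Torus) : fourier 1 t - z ≠ 0 := by
  rw [sub_ne_zero]
  rintro rfl
  exact hz.ne (norm_fourier_apply 1 t)

/-- The Herglotz kernel as a function on the circle. -/
def kern (z : ℂ) (t : Torus) : ℂ := (fourier 1 t + z) / (fourier 1 t - z)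

theorem integral_mul_eq_fourierCoeff_zero (u : C(Torus, ℂ)) (f : L2) :
    ∫ t, u t * f t ∂arc = fourierCoeff (mulC u f) 0 := by
  rw [fourierCoeff_congr_ae (coeFn_mulC u f)]
  simp only [fourierCoeff, neg_zero, fourier_zero, one_smul]

theorem eval_eq_fourierCoeff_mulC (f : L2) {z : ℂ} (hz : ‖z‖ < 1) {k : C(Torus, ℂ)}
    (hk : ∀ t, k t * (fourier 1 t - z) = 1) : eval f z = fourierCoeff (mulC k f) (-1) := by
  have hkf : mulC (fourier 1) (mulC k f) = f + z • mulC k f := by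
    have : (fourier 1 * k : C(Torus, ℂ)) = 1 + z • k := by
      ext t
      simp only [ContinuousMap.mul_apply, ContinuousMap.add_apply, ContinuousMap.one_apply,
        ContinuousMap.smul_apply, smul_eq_mul]
      linear_combination hk t
    rw [← mulC_mul, this, map_add, add_apply, mulC_one, map_smul, smul_apply]
  have heval := eval_mulC_fourier_one (mulC k f) hz
  rwa [hkf, eval_add _ _ hz, eval_smul _ _ hz, add_right_cancel_iff] at heval

theorem eval_herglotzOp (f : L2) {z : ℂ} (hz : ‖z‖ < 1) :
    eval (herglotzOp f) z = ∫ t, kern z t * f t ∂arc := by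
  let k : C(Torus, ℂ) := ⟨fun t => (fourier 1 t - z)⁻¹,
    ((fourier 1).continuous.sub continuous_const).inv₀ (fourier_one_sub_ne_zero hz)⟩
  have hk (t : Torus) : k t * (fourier 1 t - z) = 1 :=
    inv_mul_cancel₀ (fourier_one_sub_ne_zero hz t)
  have hkern (t : Torus) : kern z t = ((2 : ℂ) • (fourier 1 * k) - 1 : C(Torus, ℂ)) t := by
    simp only [kern, ContinuousMap.sub_apply, ContinuousMap.mul_apply, ContinuousMap.one_apply,
      ContinuousMap.smul_apply, smul_eq_mul]
    rw [div_eq_iff (fourier_one_sub_ne_zero hz t)]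
    linear_combination (-2) * fourier 1 t * hk t
  have hproj : eval (H2.starProjection f) z = eval f z := by
    simp only [eval, fourierCoeff_starProjection_H2]
  simp only [hkern]
  rw [integral_mul_eq_fourierCoeff_zero, map_sub, sub_apply, mulC_one, map_smul, smul_apply,
    fourierCoeff_sub, fourierCoeff_smul, mulC_mul, fourierCoeff_mulC_fourier, zero_sub,
    ← eval_eq_fourierCoeff_mulC f hz hk, ← hproj, herglotzOp_apply, sub_eq_add_neg, ← neg_smul,
    eval_add _ _ hz, eval_smul _ _ hz, eval_smul _ _ hz, eval_one hz]
  ring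

/-- The analytic completion of a real function `U`: the element of `H²` with real part `U` and real
value at `0`. -/
def analyticCompletion : Lp ℝ 2 arc →L[ℝ] L2 :=
  herglotzOp.restrictScalars ℝ ∘L Complex.ofRealCLM.compLpL 2 arc

theorem re_analyticCompletion (U : Lp ℝ 2 arc) :
    ∀ᵐ t ∂arc, (analyticCompletion U t).re = U t := by
  set V : L2 := Complex.ofRealCLM.compLpL 2 arc U
  have hV : V =ᵐ[arc] fun t => (U t : ℂ) := Complex.ofRealCLM.coeFn_compLpL U
  have hstar : star V = V := by
    apply Lp.ext
    filter_upwards [Lp.coeFn_star V, hV] with t h₁ h₂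
    rw [h₁, Pi.star_apply, h₂, RCLike.star_def, Complex.conj_ofReal]
  have hsum : herglotzOp V + star (herglotzOp V) = (2 : ℂ) • V := by
    refine ext_fourierCoeff fun n => ?_
    have hn : conj (fourierCoeff V (-n)) = fourierCoeff V n := by
      rw [← fourierCoeff_star, hstar]
    rw [fourierCoeff_add, fourierCoeff_star, fourierCoeff_smul, fourierCoeff_herglotzOp,
      fourierCoeff_herglotzOp, map_mul, hn, Int.sign_neg, map_add, map_one, map_intCast]
    push_cast
    ring
  filter_upwards [Lp.coeFn_add (herglotzOp V) (star (herglotzOp V)),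
    Lp.coeFn_star (herglotzOp V), Lp.coeFn_smul (2 : ℂ) V, hV] with t h₁ h₂ h₃ h₄
  rw [hsum, h₃, Pi.add_apply, h₂, Pi.smul_apply, h₄, Pi.star_apply] at h₁
  have hre := congrArg Complex.re h₁
  rw [smul_eq_mul, ← Complex.ofReal_ofNat, ← Complex.ofReal_mul, Complex.ofReal_re,
    RCLike.star_def, Complex.add_re, Complex.conj_re] at hre
  change (herglotzOp V t).re = _
  linarith

theorem eval_analyticCompletion (U : Lp ℝ 2 arc) {z : ℂ} (hz : ‖z‖ < 1) :
    eval (analyticCompletion U) z = ∫ t, kern z t * U t ∂arc := by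
  refine (eval_herglotzOp _ hz).trans (integral_congr_ae ?_)
  filter_upwards [Complex.ofRealCLM.coeFn_compLpL U] with t ht
  exact congrArg (kern z t * ·) ht

end AnalyticCompletion

section Approximation

theorem norm_sq_eq_integral (f : L2) : ‖f‖ ^ 2 = ∫ t, ‖f t‖ ^ 2 ∂arc := by
  have h := congrArg RCLike.re (L2.inner_def (𝕜 := ℂ) f f)
  rw [inner_self_eq_norm_sq, ← integral_re (L2.integrable_inner f f)] at h
  simpa only [inner_self_eq_norm_sq] using h

theorem tendsto_of_dominated {f : ℕ → L2} {g : L2} {b : Torus → ℝ} (hb : MemLp b 2 arc)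
    (hfb : ∀ n, ∀ᵐ t ∂arc, ‖f n t‖ ≤ b t)
    (h : ∀ᵐ t ∂arc, Tendsto (fun n => f n t) atTop (𝓝 (g t))) : Tendsto f atTop (𝓝 g) := by
  have hgb : ∀ᵐ t ∂arc, ‖g t‖ ≤ b t := by
    filter_upwards [ae_all_iff.2 hfb, h] with t h₁ h₂
    exact le_of_tendsto h₂.norm (.of_forall h₁)
  have key : Tendsto (fun n => ∫ t, ‖(f n - g : L2) t‖ ^ 2 ∂arc) atTop
      (𝓝 (∫ _, (0 : ℝ) ∂arc)) := by
    refine tendsto_integral_of_dominated_convergence (fun t => (2 * b t) ^ 2)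
      (fun n => (Lp.aestronglyMeasurable _).norm.pow 2) (hb.const_mul 2).integrable_sq
      (fun n => ?_) ?_
    · filter_upwards [hfb n, hgb, Lp.coeFn_sub (f n) g] with t h₁ h₂ h₃
      rw [h₃, Real.norm_of_nonneg (by positivity), Pi.sub_apply]
      gcongr
      linarith [norm_sub_le (f n t) (g t)]
    · filter_upwards [ae_all_iff.2 fun n => Lp.coeFn_sub (f n) g, h] with t h₁ h₂
      simp only [h₁, Pi.sub_apply]
      simpa using (tendsto_iff_norm_sub_tendsto_zero.1 h₂).pow 2
  rw [tendsto_iff_norm_sub_tendsto_zero]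
  simp only [integral_zero, ← norm_sq_eq_integral] at key
  simpa only [Real.sqrt_sq (norm_nonneg _), Real.sqrt_zero] using key.sqrt

theorem exists_subseq_tendsto_exp_mul {g : ℕ → L2} {G : L2} (hg : Tendsto g atTop (𝓝 G)) {B : ℝ}
    (hB : ∀ k, ∀ᵐ t ∂arc, (g k t).re ≤ B) {f : L2} {F : ℕ → L2}
    (hF : ∀ k, F k =ᵐ[arc] fun t => Complex.exp (g k t) * f t) {F' : L2}
    (hF' : F' =ᵐ[arc] fun t => Complex.exp (G t) * f t) :
    ∃ ns : ℕ → ℕ, StrictMono ns ∧ Tendsto (fun k => F (ns k)) atTop (𝓝 F') := by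
  obtain ⟨ns, hns, hae⟩ := (tendstoInMeasure_of_tendsto_Lp hg).exists_seq_tendsto_ae
  refine ⟨ns, hns, tendsto_of_dominated ((Lp.memLp f).norm.const_mul (Real.exp B))
    (fun k => ?_) ?_⟩
  · filter_upwards [hF (ns k), hB (ns k)] with t h₁ h₂
    rw [h₁, norm_mul, Complex.norm_exp]
    gcongr
  · filter_upwards [ae_all_iff.2 hF, hF', hae] with t h₁ h₂ h₃
    simp only [h₁, h₂]
    exact h₃.cexp.mul_const _

theorem dense_re_mem_fourierSubalgebra :
    Dense {p : C(Torus, ℝ) | Complex.ofRealCLM.compLeftContinuous ℝ Torus p ∈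
      (fourierSubalgebra : StarSubalgebra ℂ C(Torus, ℂ))} := by
  have hdense : Dense ((fourierSubalgebra : StarSubalgebra ℂ C(Torus, ℂ)) : Set C(Torus, ℂ)) := by
    intro g
    rw [← StarSubalgebra.topologicalClosure_coe, fourierSubalgebra_closure_eq_top]
    trivial
  have hsurj : Function.Surjective (Complex.reCLM.compLeftContinuous ℝ Torus) := fun p =>
    ⟨Complex.ofRealCLM.compLeftContinuous ℝ Torus p, by ext t; exact Complex.ofReal_re _⟩
  refine (hsurj.denseRange.dense_image (ContinuousLinearMap.continuous _) hdense).mono ?_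
  rintro _ ⟨g, hg, rfl⟩
  have hre : Complex.ofRealCLM.compLeftContinuous ℝ Torus (Complex.reCLM.compLeftContinuous ℝ _ g)
      = (1 / 2 : ℂ) • (g + star g) := by
    ext t
    change ((g t).re : ℂ) = 1 / 2 * (g t + conj (g t))
    rw [Complex.re_eq_add_conj]
    ring
  rw [Set.mem_ofPred_eq, hre]
  exact SMulMemClass.smul_mem _ (add_mem hg (star_mem hg))

theorem mem_closure_toLp_of_le {U : Lp ℝ 2 arc} {B : ℝ} (hU : ∀ᵐ t ∂arc, U t ≤ B) :
    U ∈ closure (ContinuousMap.toLp 2 arc ℝ '' {p : C(Torus, ℝ) | ∀ t, p t ≤ B}) := by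
  set β : Lp ℝ 2 arc := ContinuousMap.toLp 2 arc ℝ (ContinuousMap.const Torus B)
  have hβ : β =ᵐ[arc] fun _ => B := ContinuousMap.coeFn_toLp _ _
  have hmin : U ⊓ β = U := by
    refine inf_eq_left.2 ((Lp.coeFn_le _ _).1 ?_)
    filter_upwards [hU, hβ] with t h₁ h₂
    rwa [h₂]
  rw [← hmin]
  refine map_mem_closure (f := (· ⊓ β)) (continuous_id.inf continuous_const)
    (ContinuousMap.toLp_denseRange ℝ arc ℝ (by simp) U) ?_
  rintro _ ⟨v, rfl⟩
  refine ⟨v ⊓ ContinuousMap.const Torus B, fun t => inf_le_right, Lp.ext ?_⟩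
  filter_upwards [ContinuousMap.coeFn_toLp (p := 2) (𝕜 := ℝ) arc (v ⊓ ContinuousMap.const Torus B),
    ContinuousMap.coeFn_toLp (p := 2) (𝕜 := ℝ) arc v, hβ,
    Lp.coeFn_inf (ContinuousMap.toLp 2 arc ℝ v) β] with t h₁ h₂ h₃ h₄
  rw [h₁, h₄, Pi.inf_apply, h₂, h₃]
  rfl

theorem exists_herglotzOp_eq_mulC {g : C(Torus, ℂ)}
    (hg : g ∈ (fourierSubalgebra : StarSubalgebra ℂ C(Torus, ℂ))) :
    ∃ a ∈ discAlgebra, mulC a one = herglotzOp (mulC g one) := by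
  have hle : Submodule.span ℂ (Set.range fourier) ≤
      (discAlgebra.toSubmodule.map (mulC.flip one : C(Torus, ℂ) →ₗ[ℂ] L2)).comap
        (herglotzOp ∘L mulC.flip one : C(Torus, ℂ) →ₗ[ℂ] L2) := by
    rw [Submodule.span_le]
    rintro _ ⟨n, rfl⟩
    have hn : herglotzOp (mulC (fourier n) one) = (1 + n.sign : ℂ) • mulC (fourier n) one := by
      refine ext_fourierCoeff fun k => ?_
      rw [fourierCoeff_herglotzOp, fourierCoeff_smul, mulC_fourier_one, fourierCoeff_fourierLp]
      split_ifs with h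
      · rw [h]
      · simp only [mul_zero]
    refine ⟨(1 + n.sign : ℂ) • fourier n, ?_, by simpa using hn.symm⟩
    rcases lt_or_ge n 0 with h | h
    · simp [Int.sign_eq_neg_one_of_neg h]
    · lift n to ℕ using h
      exact discAlgebra.smul_mem (fourier_natCast_mem_discAlgebra n) _
  rw [← fourierSubalgebra_coe] at hle
  exact hle hg

theorem exists_seq_discAlgebra_tendsto {U : Lp ℝ 2 arc} {B : ℝ} (hU : ∀ᵐ t ∂arc, U t ≤ B) :
    ∃ a : ℕ → C(Torus, ℂ), (∀ k, a k ∈ discAlgebra) ∧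
      (∀ k, ∀ᵐ t ∂arc, (mulC (a k) one t).re ≤ B + 1) ∧
      Tendsto (fun k => mulC (a k) one) atTop (𝓝 (analyticCompletion U)) := by
  have hopen : IsOpen {p : C(Torus, ℝ) | ∀ t, p t < B + 1} := by
    simpa [Set.MapsTo] using
      ContinuousMap.isOpen_setOfPred_mapsTo (isCompact_univ (X := Torus)) (isOpen_Iio (a := B + 1))
  have hclosure := closure_mono (Set.image_mono fun p hp =>
    hopen.inter_closure (s := _) ⟨fun t => (hp t).trans_lt (lt_add_one B),
      dense_re_mem_fourierSubalgebra p⟩) (mem_closure_toLp_of_le hU)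
  have hUmem := closure_minimal (image_closure_subset_closure_image
    (ContinuousLinearMap.continuous _)) isClosed_closure hclosure
  obtain ⟨w, hw, hlim⟩ := mem_closure_iff_seq_limit.1 hUmem
  choose p hp hpw using hw
  have hreal (k : ℕ) : Complex.ofRealCLM.compLpL 2 arc (w k) =
      mulC (Complex.ofRealCLM.compLeftContinuous ℝ Torus (p k)) one := by
    apply Lp.ext
    filter_upwards [Complex.ofRealCLM.coeFn_compLpL (p := 2) (w k), coeFn_one,
      ContinuousMap.coeFn_toLp (p := 2) (𝕜 := ℝ) arc (p k),
      coeFn_mulC (Complex.ofRealCLM.compLeftContinuous ℝ Torus (p k)) one] with t h₁ h₂ h₃ h₄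
    rw [h₁, h₄, h₂, ← hpw k, h₃, mul_one]
    rfl
  choose a ha hamul using fun k => exists_herglotzOp_eq_mulC (hp k).2
  have hA (k : ℕ) : mulC (a k) one = analyticCompletion (w k) := by
    rw [hamul, ← hreal]
    rfl
  refine ⟨a, ha, fun k => ?_, ?_⟩
  · filter_upwards [re_analyticCompletion (w k),
      ContinuousMap.coeFn_toLp (p := 2) (𝕜 := ℝ) arc (p k)] with t h₁ h₂
    rw [hA, h₁, ← hpw, h₂]
    exact ((hp k).1 t).le
  · simp only [hA]
    exact (analyticCompletion.continuous.tendsto U).comp hlim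

end Approximation

section OuterExponentials

variable {U : Lp ℝ 2 arc} {B : ℝ}

theorem norm_exp_analyticCompletion (U : Lp ℝ 2 arc) :
    ∀ᵐ t ∂arc, ‖Complex.exp (analyticCompletion U t)‖ = Real.exp (U t) := by
  filter_upwards [re_analyticCompletion U] with t ht
  rw [Complex.norm_exp, ht]

theorem exists_coeFn_eq_exp_mul (hU : ∀ᵐ t ∂arc, U t ≤ B) (f : L2) :
    ∃ F : L2, F =ᵐ[arc] fun t => Complex.exp (analyticCompletion U t) * f t := by
  have hmem : MemLp (fun t => Complex.exp (analyticCompletion U t) * f t) 2 arc := by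
    refine ((Lp.memLp f).const_mul (Real.exp B : ℂ)).of_le
      ((Complex.continuous_exp.comp_aestronglyMeasurable (Lp.aestronglyMeasurable _)).mul
        (Lp.aestronglyMeasurable f)) ?_
    filter_upwards [norm_exp_analyticCompletion U, hU] with t h₁ h₂
    rw [norm_mul, h₁, norm_mul, Complex.norm_of_nonneg (Real.exp_nonneg B)]
    gcongr
  exact ⟨hmem.toLp, hmem.coeFn_toLp⟩

theorem exists_seq_mulC_exp_tendsto (hU : ∀ᵐ t ∂arc, U t ≤ B) {f F : L2}
    (hF : F =ᵐ[arc] fun t => Complex.exp (analyticCompletion U t) * f t) :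
    ∃ a : ℕ → C(Torus, ℂ), (∀ k, a k ∈ discAlgebra) ∧
      Tendsto (fun k => mulC (a k) one) atTop (𝓝 (analyticCompletion U)) ∧
      Tendsto (fun k => mulC (NormedSpace.exp (a k)) f) atTop (𝓝 F) := by
  obtain ⟨a, ha, hre, hlim⟩ := exists_seq_discAlgebra_tendsto hU
  have hexp (k : ℕ) : mulC (NormedSpace.exp (a k)) f =ᵐ[arc]
      fun t => Complex.exp (mulC (a k) one t) * f t := by
    filter_upwards [coeFn_mulC (NormedSpace.exp (a k)) f, coeFn_mulC (a k) one, coeFn_one]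
      with t h₁ h₂ h₃
    rw [h₁, h₂, h₃, mul_one, continuousMap_exp_apply]
  obtain ⟨ns, hns, hlim'⟩ := exists_subseq_tendsto_exp_mul hlim hre hexp hF
  exact ⟨a ∘ ns, fun k => ha _, hlim.comp hns.tendsto_atTop, hlim'⟩

theorem exp_analyticCompletion_mul_mem_cyclic (hU : ∀ᵐ t ∂arc, U t ≤ B) {f F : L2}
    (hF : F =ᵐ[arc] fun t => Complex.exp (analyticCompletion U t) * f t) : F ∈ cyclic f := by
  obtain ⟨a, ha, -, hlim⟩ := exists_seq_mulC_exp_tendsto hU hF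
  exact (isClosed_cyclic f).mem_of_tendsto hlim
    (.of_forall fun k => mulC_mem_cyclic (exp_mem_discAlgebra (ha k)) (mem_cyclic_self f))

theorem eval_exp_analyticCompletion_mul (hU : ∀ᵐ t ∂arc, U t ≤ B) {f F : L2} (hf : f ∈ H2)
    (hF : F =ᵐ[arc] fun t => Complex.exp (analyticCompletion U t) * f t) {z : ℂ} (hz : ‖z‖ < 1) :
    eval F z = Complex.exp (eval (analyticCompletion U) z) * eval f z := by
  obtain ⟨a, ha, hlimA, hlim⟩ := exists_seq_mulC_exp_tendsto hU hF
  refine tendsto_nhds_unique (((continuous_eval hz).tendsto F).comp hlim) ?_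
  refine ((((continuous_eval hz).tendsto _).comp hlimA).cexp.mul_const _).congr fun k => ?_
  exact (eval_mulC_exp (ha k) hf hz).symm

theorem exists_seq_tendsto_bddAbove_sub (U : Lp ℝ 2 arc) :
    ∃ W : ℕ → Lp ℝ 2 arc, Tendsto W atTop (𝓝 U) ∧ (∀ k, ∀ᵐ t ∂arc, (U - W k) t ≤ 0) ∧
      ∀ k, ∃ B, ∀ᵐ t ∂arc, (-W k) t ≤ B := by
  obtain ⟨w, hw, hlim⟩ :=
    mem_closure_iff_seq_limit.1 (ContinuousMap.toLp_denseRange ℝ arc ℝ (p := 2) (by simp) U)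
  choose v hv using hw
  refine ⟨fun k => U ⊔ w k, ?_, fun k => ?_, fun k => ⟨‖v k‖, ?_⟩⟩
  · simpa only [sup_idem] using (tendsto_const_nhds (x := U)).sup_nhds hlim
  · filter_upwards [Lp.coeFn_sub U (U ⊔ w k), Lp.coeFn_sup U (w k)] with t h₁ h₂
    rw [h₁, Pi.sub_apply, h₂, Pi.sup_apply]
    exact sub_nonpos.2 le_sup_left
  · filter_upwards [Lp.coeFn_neg (U ⊔ w k), Lp.coeFn_sup U (w k),
      ContinuousMap.coeFn_toLp (p := 2) (𝕜 := ℝ) arc (v k)] with t h₁ h₂ h₃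
    rw [h₁, Pi.neg_apply, h₂, Pi.sup_apply, ← hv, h₃, neg_le]
    exact le_sup_of_le_right (neg_le.1 ((neg_le_abs _).trans ((v k).norm_coe_le_norm t)))

theorem one_mem_cyclic_exp_analyticCompletion {F : L2}
    (hF : F =ᵐ[arc] fun t => Complex.exp (analyticCompletion U t)) : one ∈ cyclic F := by
  obtain ⟨W, hW, hle, hbdd⟩ := exists_seq_tendsto_bddAbove_sub U
  choose G hG using fun k => exists_coeFn_eq_exp_mul (hle k) one
  have hmem (k : ℕ) : G k ∈ cyclic F := by
    obtain ⟨C, hC⟩ := hbdd k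
    refine exp_analyticCompletion_mul_mem_cyclic hC ?_
    have hsub :
        analyticCompletion (U - W k) = analyticCompletion (-W k) + analyticCompletion U := by
      rw [← map_add, neg_add_eq_sub]
    filter_upwards [hG k, hF, Lp.coeFn_add (analyticCompletion (-W k)) (analyticCompletion U),
      coeFn_one] with t h₁ h₂ h₃ h₄
    rw [h₁, h₂, hsub, h₃, Pi.add_apply, Complex.exp_add, h₄, mul_one]
  have hre (k : ℕ) : ∀ᵐ t ∂arc, (analyticCompletion (U - W k) t).re ≤ 0 := by
    filter_upwards [re_analyticCompletion (U - W k), hle k] with t h₁ h₂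
    rwa [h₁]
  have hlim : Tendsto (fun k => analyticCompletion (U - W k)) atTop (𝓝 0) := by
    have hsub := (analyticCompletion.continuous.tendsto _).comp (hW.const_sub U)
    rwa [sub_self, map_zero] at hsub
  have hone : one =ᵐ[arc] fun t => Complex.exp ((0 : L2) t) * one t := by
    filter_upwards [Lp.coeFn_zero ℂ 2 arc] with t ht
    rw [ht, Pi.zero_apply, Complex.exp_zero, one_mul]
  obtain ⟨ns, -, hns⟩ := exists_subseq_tendsto_exp_mul hlim hre hG hone
  exact (isClosed_cyclic F).mem_of_tendsto hns (.of_forall fun k => hmem _)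

theorem exists_isOuter_eq_exp (hU : ∀ᵐ t ∂arc, U t ≤ B) :
    ∃ F : L2, IsOuter F ∧ (F =ᵐ[arc] fun t => Complex.exp (analyticCompletion U t)) ∧
      ∀ z, ‖z‖ < 1 → eval F z = Complex.exp (eval (analyticCompletion U) z) := by
  obtain ⟨F, hF₁⟩ := exists_coeFn_eq_exp_mul hU one
  have hF : F =ᵐ[arc] fun t => Complex.exp (analyticCompletion U t) := by
    filter_upwards [hF₁, coeFn_one] with t h₁ h₂
    rw [h₁, h₂, mul_one]
  refine ⟨F, isOuter_of_one_mem_cyclic ?_ (one_mem_cyclic_exp_analyticCompletion hF), hF,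
    fun z hz => ?_⟩
  · exact isOuter_one.le (exp_analyticCompletion_mul_mem_cyclic hU hF₁)
  · rw [eval_exp_analyticCompletion_mul hU one_mem_H2 hF₁ hz, eval_one hz, mul_one]

end OuterExponentials

section OuterUniqueness

theorem ext_fourierCoeff_of_mem_H2 {f g : L2} (hf : f ∈ H2) (hg : g ∈ H2)
    (h : ∀ n : ℕ, fourierCoeff f n = fourierCoeff g n) : f = g := by
  refine ext_fourierCoeff fun n => ?_
  rcases lt_or_ge n 0 with hn | hn
  · rw [hf n hn, hg n hn]
  · lift n to ℕ using hn
    exact h n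

theorem eq_smul_one_of_star_mem_H2 {f : L2} (hf : f ∈ H2) (hs : star f ∈ H2) :
    f = fourierCoeff f 0 • one := by
  refine ext_fourierCoeff_of_mem_H2 hf (H2.smul_mem _ one_mem_H2) fun n => ?_
  rw [fourierCoeff_smul, one, fourierCoeff_fourierLp]
  rcases n.eq_zero_or_pos with rfl | hn
  · simp only [Nat.cast_zero, if_true, mul_one]
  · have h := hs (-n) (by lia)
    rw [fourierCoeff_star, neg_neg, map_eq_zero] at h
    rw [h, if_neg (by lia), mul_zero]

theorem IsOuter.mulL_one_mem_H2 {u : Lp ℂ ∞ arc} {f : L2} (hf : IsOuter f) (h : mulL u f ∈ H2) :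
    mulL u one ∈ H2 := by
  refine map_mem_of_mem_cyclic isClosed_H2 (mulL u) (fun n => ?_) (hf.ge one_mem_H2)
  rw [mulL_mulC_comm]
  exact mulC_fourier_mem_H2 n h

theorem ae_eq_const_of_mulL_mem_H2 {u : Lp ℂ ∞ arc} {f g : L2} (hf : IsOuter f) (hg : IsOuter g)
    (huf : mulL u f ∈ H2) (hug : mulL (star u) g ∈ H2) : ∃ a : ℂ, ∀ᵐ t ∂arc, u t = a := by
  have hstar : star (mulL u one) = mulL (star u) one := by
    apply Lp.ext
    filter_upwards [Lp.coeFn_star (mulL u one), coeFn_mulL u one, coeFn_mulL (star u) one,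
      Lp.coeFn_star u, coeFn_one] with t h₁ h₂ h₃ h₄ h₅
    rw [h₁, Pi.star_apply, h₂, h₃, h₄, h₅, Pi.star_apply, mul_one, mul_one]
  have hconst := eq_smul_one_of_star_mem_H2 (hf.mulL_one_mem_H2 huf)
    (hstar ▸ hg.mulL_one_mem_H2 hug)
  set a := fourierCoeff (mulL u one) 0
  refine ⟨a, ?_⟩
  filter_upwards [coeFn_mulL u one, Lp.coeFn_smul a one, coeFn_one] with t h₁ h₂ h₃
  rwa [hconst, h₂, Pi.smul_apply, h₃, smul_eq_mul, mul_one, mul_one, eq_comm] at h₁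

theorem exists_mulL_eq {f g : L2} (hf : ∀ᵐ t ∂arc, f t ≠ 0) {C : ℝ}
    (hfg : ∀ᵐ t ∂arc, ‖g t‖ ≤ C * ‖f t‖) : ∃ u : Lp ℂ ∞ arc, mulL u f = g := by
  have hmem : MemLp (fun t => g t / f t) ∞ arc := by
    refine memLp_top_of_bound
      ((Lp.aestronglyMeasurable g).div₀ (Lp.aestronglyMeasurable f)) C ?_
    filter_upwards [hf, hfg] with t h₁ h₂
    rwa [norm_div, div_le_iff₀ (norm_pos_iff.2 h₁)]
  refine ⟨hmem.toLp, Lp.ext ?_⟩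
  filter_upwards [coeFn_mulL hmem.toLp f, hmem.coeFn_toLp, hf] with t h₁ h₂ h₃
  rw [h₁, h₂, div_mul_cancel₀ _ h₃]

theorem mulL_eq_smul {u : Lp ℂ ∞ arc} {a : ℂ} (hu : ∀ᵐ t ∂arc, u t = a) (f : L2) :
    mulL u f = a • f := by
  apply Lp.ext
  filter_upwards [coeFn_mulL u f, Lp.coeFn_smul a f, hu] with t h₁ h₂ h₃
  rw [h₁, h₂, h₃, Pi.smul_apply, smul_eq_mul]

theorem IsOuter.eq_smul_of_norm_eq {f g : L2} (hf : IsOuter f) (hg : IsOuter g)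
    (hf₀ : ∀ᵐ t ∂arc, f t ≠ 0) (hfg : ∀ᵐ t ∂arc, ‖g t‖ = ‖f t‖) :
    ∃ a : ℂ, ‖a‖ = 1 ∧ g = a • f := by
  obtain ⟨u, rfl⟩ := exists_mulL_eq hf₀ (hfg.mono fun t h => (h.trans (one_mul _).symm).le)
  have hnorm : ∀ᵐ t ∂arc, ‖u t‖ = 1 := by
    filter_upwards [hfg, coeFn_mulL u f, hf₀] with t h₁ h₂ h₃
    rw [h₂, norm_mul] at h₁
    exact mul_eq_right₀ (norm_ne_zero_iff.2 h₃) |>.1 h₁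
  have hinv : mulL (star u) (mulL u f) = f := by
    apply Lp.ext
    filter_upwards [coeFn_mulL (star u) (mulL u f), Lp.coeFn_star u, coeFn_mulL u f, hnorm]
      with t h₁ h₂ h₃ h₄
    rw [h₁, h₂, h₃, Pi.star_apply, ← mul_assoc, RCLike.star_def, RCLike.conj_mul, h₄,
      RCLike.ofReal_one, one_pow, one_mul]
  obtain ⟨a, ha⟩ := ae_eq_const_of_mulL_mem_H2 hf hg hg.mem_H2 (hinv.symm ▸ hf.mem_H2)
  obtain ⟨t, hat, hut⟩ := (ha.and hnorm).exists
  exact ⟨a, hat ▸ hut, mulL_eq_smul ha f⟩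

end OuterUniqueness

section QuadraticPolynomial

theorem tendsto_norm_fourierCoeff_atTop (f : L2) :
    Tendsto (fun n : ℕ => ‖fourierCoeff f n‖) atTop (𝓝 0) := by
  have h := ((hasSum_sq_fourierCoeff f).summable.comp_injective
    (i := ((↑) : ℕ → ℤ)) Nat.cast_injective).tendsto_atTop_zero.sqrt
  simpa only [Function.comp_def, Real.sqrt_sq (norm_nonneg _), Real.sqrt_zero] using h

theorem eq_zero_of_norm_fourierCoeff_add_two {f : L2} (hf : f ∈ H2)
    (h : ∀ n : ℕ, ‖fourierCoeff f (n + 2 : ℕ)‖ = ‖fourierCoeff f n‖) : f = 0 := by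
  refine ext_fourierCoeff_of_mem_H2 hf H2.zero_mem fun n => ?_
  have hconst (j : ℕ) : ‖fourierCoeff f (n + 2 * j : ℕ)‖ = ‖fourierCoeff f n‖ := by
    induction j with
    | zero => rfl
    | succ j ih => rw [← ih, ← h (n + 2 * j)]; rfl
  have hsub : Tendsto (fun j : ℕ => n + 2 * j) atTop atTop :=
    tendsto_atTop_mono (fun j => by simp only [id]; lia) tendsto_id
  have hlim := (tendsto_norm_fourierCoeff_atTop f).comp hsub
  simp only [Function.comp_def, hconst] at hlim
  rw [fourierCoeff_zero, ← norm_eq_zero]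
  exact tendsto_nhds_unique tendsto_const_nhds hlim

theorem isOuter_quadratic {c : ℂ} (hc : c ≠ 0) :
    IsOuter (c • (fourierLp 2 2 : L2) + conj c • one) := by
  set p : L2 := c • (fourierLp 2 2 : L2) + conj c • one with hp
  have hpH : p ∈ H2 :=
    H2.add_mem (H2.smul_mem _ (fourierLp_mem_H2 2)) (H2.smul_mem _ one_mem_H2)
  refine le_antisymm (cyclic_le_H2 hpH) fun f hf => ?_
  have : CompleteSpace (cyclic p) := (isClosed_cyclic p).completeSpace_coe
  have hproj : (cyclic p).starProjection f ∈ cyclic p := Submodule.starProjection_apply_mem _ _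
  set k := f - (cyclic p).starProjection f
  have hkH : k ∈ H2 := H2.sub_mem hf (cyclic_le_H2 hpH hproj)
  have hrec (n : ℕ) : ‖fourierCoeff k (n + 2 : ℕ)‖ = ‖fourierCoeff k n‖ := by
    have hshift : mulC (fourier n) p =
        c • (fourierLp 2 ((n + 2 : ℕ) : ℤ) : L2) + conj c • (fourierLp 2 (n : ℤ) : L2) := by
      rw [hp, map_add, map_smul, map_smul, mulC_fourier_one, ← mulC_fourier_one 2, ← mulC_mul,
        fourier_mul, mulC_fourier_one]
      rfl
    have horth := Submodule.inner_right_of_mem_orthogonal (mulC_fourier_mem_cyclic p n)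
      (Submodule.sub_starProjection_mem_orthogonal f)
    rw [hshift, inner_add_left, inner_smul_left, inner_smul_left, ← fourierCoeff_eq_inner,
      ← fourierCoeff_eq_inner, Complex.conj_conj] at horth
    have hnorm := congrArg norm (eq_neg_of_add_eq_zero_left horth)
    rw [norm_neg, norm_mul, norm_mul, RCLike.norm_conj] at hnorm
    exact mul_left_cancel₀ (norm_ne_zero_iff.2 hc) hnorm
  have hfk : f = (cyclic p).starProjection f :=
    sub_eq_zero.1 (eq_zero_of_norm_fourierCoeff_add_two hkH hrec)
  exact hfk ▸ hproj

end QuadraticPolynomial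

section IntegrableFunctions

theorem ae_eq_zero_of_forall_integral_boundedContinuous_smul {X E : Type*} [TopologicalSpace X]
    [HasOuterApproxClosed X] [MeasurableSpace X] [BorelSpace X] {μ : Measure X}
    [NormedAddCommGroup E] [NormedSpace ℝ E] [CompleteSpace E] {w : X → E} (hw : Integrable w μ)
    (h : ∀ g : BoundedContinuousFunction X NNReal, ∫ x, (g x : ℝ) • w x ∂μ = 0) : w =ᵐ[μ] 0 := by
  refine ae_eq_zero_of_forall_setIntegral_isClosed_eq_zero hw fun F hF => ?_
  have hlim : Tendsto (fun n => ∫ x, (hF.apprSeq n x : ℝ) • w x ∂μ) atTop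
      (𝓝 (∫ x, F.indicator w x ∂μ)) := by
    refine tendsto_integral_of_dominated_convergence (fun x => ‖w x‖)
      (fun n => ?_) hw.norm (fun n => .of_forall fun x => ?_) (.of_forall fun x => ?_)
    · exact (Continuous.aestronglyMeasurable (by fun_prop)).smul hw.1
    · rw [norm_smul, Real.norm_of_nonneg (NNReal.coe_nonneg _)]
      exact mul_le_of_le_one_left (norm_nonneg _)
        (mod_cast HasOuterApproxClosed.apprSeq_apply_le_one hF n x)
    · have hx := (NNReal.continuous_coe.tendsto _).comp
        (tendsto_pi_nhds.1 (HasOuterApproxClosed.tendsto_apprSeq hF) x)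
      convert! hx.smul_const (w x) using 2
      by_cases hxF : x ∈ F <;> simp [hxF]
  rw [← integral_indicator hF.measurableSet]
  exact tendsto_nhds_unique hlim (tendsto_const_nhds.congr fun n => (h _).symm)

theorem exists_clm_eq_integral_mul {w : Torus → ℂ} (hw : Integrable w arc) :
    ∃ L : C(Torus, ℂ) →L[ℂ] ℂ, ∀ g, L g = ∫ t, g t * w t ∂arc := by
  refine ⟨L1.integralCLM' ℂ ∘L ((ContinuousLinearMap.mul ℂ ℂ).holderL arc ∞ 1 1).flip
    (hw.toL1 w) ∘L ContinuousMap.toLp ∞ arc ℂ, fun g => ?_⟩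
  refine (L1.integral_eq' ℂ _).symm.trans
    ((L1.integral_eq_integral _).trans (integral_congr_ae ?_))
  filter_upwards [(ContinuousLinearMap.mul ℂ ℂ).coeFn_holder (r := 1)
      (ContinuousMap.toLp ∞ arc ℂ g) (hw.toL1 w), hw.coeFn_toL1,
    ContinuousMap.coeFn_toLp (p := ∞) (𝕜 := ℂ) arc g] with t h₁ h₂ h₃
  rw [← h₂, ← h₃]
  exact h₁

theorem ae_eq_zero_of_fourierCoeff_eq_zero {w : Torus → ℂ} (hw : Integrable w arc)
    (h : ∀ n, fourierCoeff w n = 0) : w =ᵐ[arc] 0 := by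
  obtain ⟨L, hL⟩ := exists_clm_eq_integral_mul hw
  have hL₀ : L = 0 := by
    refine ContinuousLinearMap.ext_on (s := Set.range fourier) ?_ ?_
    · rw [dense_iff_closure_eq, ← Submodule.topologicalClosure_coe, span_fourier_closure_eq_top]
      rfl
    · rintro _ ⟨n, rfl⟩
      rw [hL, zero_apply]
      simpa only [fourierCoeff, neg_neg, smul_eq_mul] using h (-n)
  refine ae_eq_zero_of_forall_integral_boundedContinuous_smul hw fun g => ?_
  exact (hL ⟨fun t => ((g t : ℝ) : ℂ), by fun_prop⟩).symm.trans (by rw [hL₀]; rfl)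

end IntegrableFunctions

section RealTrigonometricPolynomials

theorem ofReal_trig (c : ℂ) (t : Torus) :
    (trig c t : ℂ) = c * fourier 1 t + conj (c * fourier 1 t) := by
  rw [Complex.add_conj, trig]

theorem continuous_trig (c : ℂ) : Continuous (trig c) := by
  unfold trig
  fun_prop

theorem abs_trig_le (c : ℂ) (t : Torus) : |trig c t| ≤ 2 * ‖c‖ := by
  rw [trig, abs_mul, abs_two]
  gcongr
  refine (Complex.abs_re_le_norm _).trans ?_
  rw [norm_mul, norm_fourier_apply, mul_one]

theorem fourier_one_coe (x : ℝ) : (fourier 1 (x : Torus) : ℂ) = Complex.exp (x * Complex.I) := by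
  rw [fourier_coe_apply]
  congr 1
  push_cast
  field_simp

theorem trig_coe (c : ℂ) (x : ℝ) :
    trig c (x : Torus) = 2 * ‖c‖ * Real.sin (x + (c.arg + Real.pi / 2)) := by
  rw [trig, fourier_one_coe]
  nth_rw 1 [← Complex.norm_mul_exp_arg_mul_I c]
  rw [mul_assoc, ← Complex.exp_add, ← add_mul, Complex.re_ofReal_mul, ← Complex.ofReal_add,
    Complex.exp_ofReal_mul_I_re, ← add_assoc, Real.sin_add_pi_div_two, add_comm x, mul_assoc]

theorem trig_ofReal_mul (r : ℝ) (c : ℂ) (t : Torus) : trig (r * c) t = r * trig c t := by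
  rw [trig, trig, mul_assoc, Complex.re_ofReal_mul]
  ring

theorem arc_eq_smul_map : arc = (ENNReal.ofReal (2 * Real.pi))⁻¹ •
    (volume.restrict (Set.Ioc 0 (2 * Real.pi))).map ((↑) : ℝ → Torus) := by
  have h := (AddCircle.measurePreserving_mk (2 * Real.pi) 0).map_eq
  rw [zero_add] at h
  rw [h, volume_eq_smul_haarAddCircle, smul_smul,
    ENNReal.inv_mul_cancel (by simp [Real.pi_pos]) (by finiteness), one_smul]

theorem trig_ne_zero {c : ℂ} (hc : c ≠ 0) : ∀ᵐ t ∂arc, trig c t ≠ 0 := by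
  rw [arc_eq_smul_map]
  refine Measure.ae_smul_measure ((ae_map_iff AddCircle.measurable_mk'.aemeasurable
    (isOpen_ne_fun (continuous_trig c) continuous_const).measurableSet).2 ?_) _
  refine ae_restrict_of_ae (ae_iff.2 (Set.Countable.measure_zero ((Set.countable_range
    fun n : ℤ => n * Real.pi - (c.arg + Real.pi / 2)).mono fun x hx => ?_) _))
  simp only [ne_eq, not_not, Set.mem_ofPred_eq] at hx
  rw [trig_coe, mul_eq_zero_iff_left (by simpa using hc), Real.sin_eq_zero_iff] at hx
  obtain ⟨n, hn⟩ := hx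
  exact ⟨n, by simp only [hn, add_sub_cancel_right]⟩

theorem log_sq_le_rpow {s : ℝ} (hs : 0 < s) (hs₁ : s ≤ 1) :
    Real.log s ^ 2 ≤ 16 * s ^ (-1 / 2 : ℝ) := by
  have hlog : |Real.log s| ≤ 4 * s ^ (-1 / 4 : ℝ) := by
    have h := (Real.abs_log_mul_self_rpow_lt s (1 / 4) hs hs₁ (by norm_num)).le
    have hpow : (0 : ℝ) < s ^ (1 / 4 : ℝ) := Real.rpow_pos_of_pos hs _
    rw [abs_mul, abs_of_pos hpow, one_div_one_div] at h
    rwa [neg_div, Real.rpow_neg hs.le, ← div_eq_mul_inv, le_div_iff₀ hpow]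
  calc Real.log s ^ 2 = |Real.log s| ^ 2 := (sq_abs _).symm
    _ ≤ (4 * s ^ (-1 / 4 : ℝ)) ^ 2 := by gcongr
    _ = 16 * s ^ (-1 / 2 : ℝ) := by
      rw [mul_pow, ← Real.rpow_natCast (s ^ _), ← Real.rpow_mul hs.le]
      norm_num

theorem intervalIntegrable_log_sin_sq_zero_pi_div_two :
    IntervalIntegrable (fun x => Real.log (Real.sin x) ^ 2) volume 0 (Real.pi / 2) := by
  have hr : IntervalIntegrable (fun x : ℝ => 16 * (2 / Real.pi * x) ^ (-1 / 2 : ℝ)) volume 0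
      (Real.pi / 2) := by
    have h := (intervalIntegral.intervalIntegrable_rpow' (a := 0) (b := 1)
      (r := (-1 / 2 : ℝ)) (by norm_num)).comp_mul_left (c := 2 / Real.pi)
    rw [zero_div, one_div_div] at h
    exact h.const_mul 16
  refine hr.mono_fun (Measurable.aestronglyMeasurable (by fun_prop)) ?_
  rw [Set.uIoc_of_le (by positivity)]
  filter_upwards [ae_restrict_mem measurableSet_Ioc] with x hx
  have hpos : 0 < 2 / Real.pi * x := mul_pos (by positivity) hx.1
  have hsin : 2 / Real.pi * x ≤ Real.sin x := Real.mul_le_sin hx.1.le hx.2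
  rw [Real.norm_of_nonneg (sq_nonneg _), Real.norm_of_nonneg (by positivity)]
  refine (log_sq_le_rpow (hpos.trans_le hsin) (Real.sin_le_one x)).trans ?_
  gcongr 16 * ?_
  exact Real.rpow_le_rpow_of_nonpos hpos hsin (by norm_num)

theorem intervalIntegrable_log_sin_sq (a b : ℝ) :
    IntervalIntegrable (fun x => Real.log (Real.sin x) ^ 2) volume a b := by
  have h₁ := intervalIntegrable_log_sin_sq_zero_pi_div_two
  have h₂ : IntervalIntegrable (fun x => Real.log (Real.sin x) ^ 2) volume (Real.pi / 2)
      Real.pi := by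
    have h := (h₁.comp_sub_left Real.pi).symm
    simp only [Real.sin_pi_sub, sub_zero] at h
    convert! h using 1
    ring
  refine Function.Periodic.intervalIntegrable₀ (T := Real.pi) (fun x => ?_) Real.pi_ne_zero
    (h₁.trans h₂) a b
  simp only [Real.sin_add_pi, Real.log_neg_eq_log]

theorem memLp_log_sin_add (β a b : ℝ) :
    MemLp (fun x => Real.log (Real.sin (x + β))) 2 (volume.restrict (Set.Ioc a b)) := by
  rcases lt_or_ge b a with hab | hab
  · simp [Set.Ioc_eq_empty_of_le hab.le]
  refine (memLp_two_iff_integrable_sq (Measurable.aestronglyMeasurable (by fun_prop))).2 ?_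
  rw [← IntegrableOn, ← intervalIntegrable_iff_integrableOn_Ioc_of_le hab]
  have h := (intervalIntegrable_log_sin_sq (a + β) (b + β)).comp_add_right β
  rwa [add_sub_cancel_right, add_sub_cancel_right] at h

theorem memLp_log_trig (c : ℂ) : MemLp (fun t => Real.log |trig c t|) 2 arc := by
  rcases eq_or_ne c 0 with rfl | hc
  · simp [trig]
  have hmeas : Measurable fun t => Real.log |trig c t| :=
    Real.measurable_log.comp (continuous_trig c).abs.measurable
  rw [arc_eq_smul_map]
  refine MemLp.smul_measure ((memLp_map_measure_iff hmeas.aestronglyMeasurable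
    AddCircle.measurable_mk'.aemeasurable).2 ?_) (by simp [Real.pi_pos])
  refine ((memLp_const |Real.log (2 * ‖c‖)|).add
    (memLp_log_sin_add (c.arg + Real.pi / 2) _ _).norm).of_le
    (hmeas.comp AddCircle.measurable_mk').aestronglyMeasurable (.of_forall fun x => ?_)
  rw [Pi.add_apply, Real.norm_of_nonneg (r := |_| + _) (by positivity), Function.comp_apply,
    Real.log_abs, trig_coe, Real.norm_eq_abs, Real.norm_eq_abs]
  rcases eq_or_ne (Real.sin (x + (c.arg + Real.pi / 2))) 0 with h | h
  · rw [h, mul_zero, Real.log_zero, abs_zero, add_zero]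
    positivity
  · rw [Real.log_mul (by simpa using hc) h]
    exact abs_add_le _ _

/-- The function `log |cχ + conj (cχ)|`, as an element of the real space `L²`. -/
def logTrig (c : ℂ) : Lp ℝ 2 arc := (memLp_log_trig c).toLp _

theorem coeFn_logTrig (c : ℂ) : logTrig c =ᵐ[arc] fun t => Real.log |trig c t| :=
  (memLp_log_trig c).coeFn_toLp

theorem fourierCoeff_trig (c : ℂ) (n : ℤ) :
    fourierCoeff (fun t => (trig c t : ℂ)) n =
      (if n = 1 then c else 0) + (if n = -1 then conj c else 0) := by
  have hT : (fun t => (trig c t : ℂ)) =ᵐ[arc]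
      (c • (fourierLp 2 1 : L2) + conj c • (fourierLp 2 (-1) : L2) : L2) := by
    filter_upwards [Lp.coeFn_add (c • (fourierLp 2 1 : L2)) (conj c • (fourierLp 2 (-1) : L2)),
      Lp.coeFn_smul c (fourierLp 2 1 : L2), Lp.coeFn_smul (conj c) (fourierLp 2 (-1) : L2),
      coeFn_fourierLp (T := 2 * Real.pi) 2 1, coeFn_fourierLp (T := 2 * Real.pi) 2 (-1)]
      with t h₁ h₂ h₃ h₄ h₅
    rw [h₁, Pi.add_apply, h₂, h₃, Pi.smul_apply, Pi.smul_apply, h₄, h₅, ofReal_trig, map_mul,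
      fourier_neg, smul_eq_mul, smul_eq_mul]
  rw [fourierCoeff_congr_ae hT, fourierCoeff_add, fourierCoeff_smul, fourierCoeff_smul,
    fourierCoeff_fourierLp, fourierCoeff_fourierLp]
  simp only [mul_ite, mul_one, mul_zero]

theorem fourierCoeff_ofReal_neg (w : Torus → ℝ) (n : ℤ) :
    fourierCoeff (fun t => (w t : ℂ)) (-n) = conj (fourierCoeff (fun t => (w t : ℂ)) n) := by
  unfold fourierCoeff
  rw [← integral_conj]
  congr 1
  ext t
  rw [smul_eq_mul, smul_eq_mul, map_mul, Complex.conj_ofReal, ← fourier_neg]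

theorem ae_eq_trig_of_fourierCoeff_eq_zero {w : Torus → ℝ} (hw : Integrable w arc)
    (h₀ : fourierCoeff (fun t => (w t : ℂ)) 0 = 0)
    (h₂ : ∀ n : ℕ, 2 ≤ n → fourierCoeff (fun t => (w t : ℂ)) n = 0) :
    ∀ᵐ t ∂arc, w t = trig (fourierCoeff (fun t => (w t : ℂ)) 1) t := by
  set c := fourierCoeff (fun t => (w t : ℂ)) 1
  have hi : Integrable (fun t => (trig c t : ℂ)) arc :=
    (Complex.continuous_ofReal.comp (continuous_trig c)).integrable_of_hasCompactSupport
      (HasCompactSupport.of_compactSpace _)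
  have hnat (n : ℕ) : fourierCoeff (fun t => (w t : ℂ)) n =
      fourierCoeff (fun t => (trig c t : ℂ)) n := by
    rw [fourierCoeff_trig, if_neg (show (n : ℤ) ≠ -1 by lia), add_zero]
    rcases lt_or_ge n 2 with hn | hn
    · interval_cases n
      · exact h₀
      · rfl
    · rw [h₂ n hn, if_neg (by lia)]
  have hz := ae_eq_zero_of_fourierCoeff_eq_zero (hw.ofReal.sub hi) fun n => ?_
  · filter_upwards [hz] with t ht
    exact Complex.ofReal_injective (sub_eq_zero.1 ht)
  have hsub : fourierCoeff ((fun t => (w t : ℂ)) - fun t => (trig c t : ℂ)) n =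
      fourierCoeff (fun t => (w t : ℂ)) n - fourierCoeff (fun t => (trig c t : ℂ)) n := by
    simp only [fourierCoeff, Pi.sub_apply, smul_sub]
    exact integral_sub (hw.ofReal.fourier_smul _) (hi.fourier_smul _)
  refine hsub.trans (sub_eq_zero.2 ?_)
  obtain ⟨k, rfl | rfl⟩ := n.eq_nat_or_neg
  · exact hnat k
  · rw [fourierCoeff_ofReal_neg, fourierCoeff_ofReal_neg, hnat]

theorem trig_mul_trig (c d : ℂ) (t : Torus) :
    trig c t * trig d t = 2 * (c * d * fourier 1 t ^ 2).re + 2 * (c * conj d).re := by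
  have hz : (fourier 1 t : ℂ) * conj (fourier 1 t : ℂ) = 1 := by
    rw [Complex.mul_conj', norm_fourier_apply, Complex.ofReal_one, one_pow]
  rw [← Complex.ofReal_inj]
  push_cast
  rw [ofReal_trig, ofReal_trig, Complex.re_eq_add_conj, Complex.re_eq_add_conj]
  simp only [map_mul, map_pow, Complex.conj_conj]
  linear_combination (c * conj d + conj c * d) * hz

theorem exists_nonneg_eq_mul_of_trig_mul_nonneg {c d : ℂ} (hc : c ≠ 0)
    (h : ∀ᵐ t ∂arc, 0 ≤ trig c t * trig d t) : ∃ r : ℝ, 0 ≤ r ∧ d = r * c := by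
  have hall (t : Torus) : 0 ≤ trig c t * trig d t :=
    (isClosed_le (f := fun _ => 0) (g := fun t => trig c t * trig d t) continuous_const
      ((continuous_trig c).mul (continuous_trig d))).closure_eq.le (Measure.dense_of_ae h t)
  -- At the point `z` of the circle with `c d z ^ 2 = -‖c d‖` the first term of `trig_mul_trig`
  -- is as small as possible.
  have hmin := hall ((Real.pi - (c * d).arg) / 2 : ℝ)
  have hz : c * d * fourier 1 (((Real.pi - (c * d).arg) / 2 : ℝ) : Torus) ^ 2 =
      ((-‖c * d‖ : ℝ) : ℂ) := by
    rw [fourier_one_coe, ← Complex.exp_nat_mul]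
    nth_rw 1 [← Complex.norm_mul_exp_arg_mul_I (c * d)]
    rw [mul_assoc, ← Complex.exp_add, Complex.ofReal_neg, ← mul_neg_one, ← Complex.exp_pi_mul_I]
    congr 2
    push_cast
    ring
  have hre : (d * conj c).re = ‖d * conj c‖ := by
    refine le_antisymm (Complex.re_le_norm _) ?_
    have hconj : (d * conj c).re = (c * conj d).re := by
      rw [← Complex.conj_re, map_mul, Complex.conj_conj, mul_comm]
    rw [trig_mul_trig, hz, Complex.ofReal_re, norm_mul] at hmin
    rw [hconj, norm_mul, RCLike.norm_conj]
    linarith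
  have him : (d * conj c).im = 0 := Complex.abs_re_eq_norm.1 (by rw [hre, abs_norm])
  refine ⟨(d * conj c).re / ‖c‖ ^ 2, by rw [hre]; positivity, ?_⟩
  have hreal : d * conj c = ((d * conj c).re : ℂ) := Complex.ext rfl him
  rw [Complex.ofReal_div, ← hreal, Complex.ofReal_pow, ← Complex.mul_conj',
    mul_div_mul_right _ _ ((map_ne_zero _).2 hc), div_mul_cancel₀ _ hc]

end RealTrigonometricPolynomials

section Symbol

theorem exists_ae_abs_le {α : Type*} [MeasurableSpace α] {μ : Measure α} {φ : α → ℝ}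
    (hφ : MemLp φ ∞ μ) : ∃ C, ∀ᵐ x ∂μ, |φ x| ≤ C := by
  have htop : eLpNormEssSup φ μ ≠ ∞ := eLpNorm_exponent_top (f := φ) ▸ hφ.2.ne
  refine ⟨(eLpNormEssSup φ μ).toReal, ?_⟩
  filter_upwards [ae_le_eLpNormEssSup (f := φ) (μ := μ)] with t ht
  rw [← Real.norm_eq_abs, ← toReal_enorm]
  exact ENNReal.toReal_mono htop ht

theorem exists_bounds_sub_mul_pos {α : Type*} [MeasurableSpace α] {μ : Measure α} {φ s : α → ℝ}
    (hφ : MemLp φ ∞ μ) (hs : Measurable s) (hs₀ : ∀ᵐ x ∂μ, s x ≠ 0) {l : ℝ}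
    (hl : l ∈ Set.Ioo (essSup φ (μ.restrict {x | s x < 0}))
      (essInf φ (μ.restrict {x | 0 < s x}))) :
    ∃ δ C : ℝ, 0 < δ ∧ ∀ᵐ x ∂μ, δ ≤ |φ x - l| ∧ |φ x - l| ≤ C ∧ 0 < (φ x - l) * s x := by
  obtain ⟨C, hC⟩ := exists_ae_abs_le hφ
  set m := essSup φ (μ.restrict {x | s x < 0})
  set M := essInf φ (μ.restrict {x | 0 < s x})
  have hneg : ∀ᵐ x ∂μ, s x < 0 → φ x ≤ m :=
    (ae_restrict_iff' (measurableSet_lt hs measurable_const)).1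
      (ae_le_essSup ⟨C, ae_restrict_of_ae (hC.mono fun x h => (abs_le.1 h).2)⟩)
  have hpos : ∀ᵐ x ∂μ, 0 < s x → M ≤ φ x :=
    (ae_restrict_iff' (measurableSet_lt measurable_const hs)).1
      (ae_essInf_le ⟨-C, ae_restrict_of_ae (hC.mono fun x h => (abs_le.1 h).1)⟩)
  refine ⟨min (l - m) (M - l), C + |l|, lt_min (sub_pos.2 hl.1) (sub_pos.2 hl.2), ?_⟩
  filter_upwards [hneg, hpos, hC, hs₀] with x hx_neg hx_pos hx hx₀
  refine ⟨le_abs.2 ?_, (abs_sub _ _).trans (by gcongr), ?_⟩ <;>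
    rcases lt_or_gt_of_ne hx₀ with h | h
  · exact .inr ((min_le_left _ _).trans (by linarith [hx_neg h]))
  · exact .inl ((min_le_right _ _).trans (by linarith [hx_pos h]))
  · exact mul_pos_of_neg_of_neg (by linarith [hx_neg h, hl.1]) h
  · exact mul_pos (by linarith [hx_pos h, hl.2]) h

theorem exists_Lp_eq_log_abs {α : Type*} [MeasurableSpace α] {μ : Measure α} [IsFiniteMeasure μ]
    {ψ : α → ℝ} (hψ : AEMeasurable ψ μ) {δ C : ℝ} (hδ : 0 < δ)
    (h : ∀ᵐ x ∂μ, δ ≤ |ψ x| ∧ |ψ x| ≤ C) (p : ℝ≥0∞) : ∃ L : Lp ℝ p μ,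
      L =ᵐ[μ] (fun x => Real.log |ψ x|) ∧ ∀ᵐ x ∂μ, Real.log δ ≤ L x ∧ L x ≤ Real.log C := by
  have hlog : ∀ᵐ x ∂μ, Real.log δ ≤ Real.log |ψ x| ∧ Real.log |ψ x| ≤ Real.log C :=
    h.mono fun x hx => ⟨Real.log_le_log hδ hx.1, Real.log_le_log (hδ.trans_le hx.1) hx.2⟩
  have hmem : MemLp (fun x => Real.log |ψ x|) p μ :=
    .of_bound (Real.measurable_log.comp_aemeasurable hψ.norm).aestronglyMeasurable
      (max |Real.log δ| |Real.log C|) (hlog.mono fun x hx => abs_le_max_abs_abs hx.1 hx.2)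
  refine ⟨hmem.toLp, hmem.coeFn_toLp, ?_⟩
  filter_upwards [hmem.coeFn_toLp, hlog] with x h₁ h₂
  rwa [h₁]

end Symbol

section HerglotzIntegrals

theorem integral_arc (f : Torus → ℂ) :
    ∫ t, f t ∂arc = (1 / (2 * Real.pi) : ℂ) * ∫ t in (-Real.pi)..Real.pi, f (t : Torus) := by
  have h := fourierCoeff_eq_intervalIntegral f 0 (-Real.pi)
  simp only [fourierCoeff, neg_zero, fourier_zero, one_smul] at h
  rw [h, show -Real.pi + 2 * Real.pi = Real.pi by ring, Complex.real_smul]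
  push_cast
  rfl

theorem herglotz_eq_kern (z : ℂ) (t : ℝ) : herglotz z t = kern z (t : Torus) := by
  rw [herglotz, kern, fourier_one_coe, mul_comm Complex.I]

theorem exp_herglotz_integral {u : Torus → ℝ} {U : Lp ℝ 2 arc} (hU : U =ᵐ[arc] u) {z : ℂ}
    (hz : ‖z‖ < 1) :
    Complex.exp ((1 / (2 * Real.pi) : ℂ) * ∫ t in (-Real.pi)..Real.pi,
      herglotz z t * (u (t : Torus) : ℂ)) = Complex.exp (eval (analyticCompletion U) z) := by
  simp only [herglotz_eq_kern]
  rw [← integral_arc fun t => kern z t * (u t : ℂ), eval_analyticCompletion U hz]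
  refine congrArg Complex.exp (integral_congr_ae ?_)
  filter_upwards [hU] with t ht
  rw [ht]

theorem log_rpow_of_nonneg {x : ℝ} (hx : 0 ≤ x) {y : ℝ} (hy : y ≠ 0) :
    Real.log (x ^ y) = y * Real.log x := by
  rcases hx.eq_or_lt with rfl | hx
  · rw [Real.zero_rpow hy, Real.log_zero, mul_zero]
  · exact Real.log_rpow hx y

theorem hFun_eq (c : ℂ) {z : ℂ} (hz : ‖z‖ < 1) :
    hFun c z = Complex.exp (eval (analyticCompletion ((1 / 2 : ℝ) • logTrig c)) z) := by
  have hU : ((1 / 2 : ℝ) • logTrig c : Lp ℝ 2 arc) =ᵐ[arc]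
      fun t => 1 / 2 * Real.log |trig c t| := by
    filter_upwards [Lp.coeFn_smul (1 / 2 : ℝ) (logTrig c), coeFn_logTrig c] with t h₁ h₂
    rw [h₁, Pi.smul_apply, h₂, smul_eq_mul]
  rw [← exp_herglotz_integral hU hz, hFun]
  refine congrArg Complex.exp (congrArg _ (intervalIntegral.integral_congr fun t _ => ?_))
  have htrig : c * Complex.exp (Complex.I * t) + conj c * Complex.exp (-(Complex.I * t)) =
      (trig c (t : Torus) : ℂ) := by
    rw [ofReal_trig, fourier_one_coe, mul_comm (t : ℂ), map_mul, ← Complex.exp_conj, map_mul,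
      Complex.conj_I, Complex.conj_ofReal, neg_mul]
  simp only [htrig, Complex.norm_real, Real.norm_eq_abs]
  rw [log_rpow_of_nonneg (abs_nonneg _) (by norm_num)]

theorem gFun_eq {φ : Torus → ℝ} {l : ℝ} {L : Lp ℝ 2 arc}
    (hL : L =ᵐ[arc] fun t => Real.log |φ t - l|) {z : ℂ} (hz : ‖z‖ < 1) :
    gFun φ l z = Complex.exp (eval (analyticCompletion ((-1 / 2 : ℝ) • L)) z) := by
  have hU : ((-1 / 2 : ℝ) • L : Lp ℝ 2 arc) =ᵐ[arc]
      fun t => -1 / 2 * Real.log |φ t - l| := by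
    filter_upwards [Lp.coeFn_smul (-1 / 2 : ℝ) L, hL] with t h₁ h₂
    rw [h₁, Pi.smul_apply, h₂, smul_eq_mul]
  rw [← exp_herglotz_integral hU hz, gFun]
  refine congrArg Complex.exp (congrArg _ (intervalIntegral.integral_congr fun t _ => ?_))
  rw [log_rpow_of_nonneg (abs_nonneg _) (by norm_num)]

end HerglotzIntegrals

section SymbolMultiplication

/-- Multiplication by a real-valued `ψ ∈ L^∞`, as a bounded operator on `L²`. -/
def symbolMul (ψ : Torus → ℝ) (hψ : MemLp ψ ∞ arc) : L2 →L[ℂ] L2 :=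
  mulL (MemLp.toLp (fun t => (ψ t : ℂ)) hψ.ofReal)

/-- The function `χ (ψ f)^*`. It lies in `H²` exactly when `ψ f` has no Fourier coefficients of
index at least `2`, that is, when `ψ f` is orthogonal to `z² H²`. -/
def companion (ψ : Torus → ℝ) (hψ : MemLp ψ ∞ arc) (f : L2) : L2 :=
  mulC (fourier 1) (star (symbolMul ψ hψ f))

theorem integrable_mul_norm_sq {ψ : Torus → ℝ} (hψ : MemLp ψ ∞ arc) (f : L2) :
    Integrable (fun t => ψ t * ‖f t‖ ^ 2) arc :=
  ((memLp_two_iff_integrable_sq_norm (Lp.aestronglyMeasurable f)).1 (Lp.memLp f)).bdd_mul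
    hψ.1 (exists_ae_abs_le hψ).choose_spec

variable {ψ : Torus → ℝ} (hψ : MemLp ψ ∞ arc) (f : L2)

theorem coeFn_symbolMul : symbolMul ψ hψ f =ᵐ[arc] fun t => (ψ t : ℂ) * f t := by
  filter_upwards [coeFn_mulL (MemLp.toLp (fun t => (ψ t : ℂ)) hψ.ofReal) f,
    MemLp.coeFn_toLp (f := fun t => (ψ t : ℂ)) hψ.ofReal] with t h₁ h₂
  rw [symbolMul, h₁, h₂]

theorem coeFn_companion :
    companion ψ hψ f =ᵐ[arc] fun t => fourier 1 t * ((ψ t : ℂ) * conj (f t)) := by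
  filter_upwards [coeFn_mulC (fourier 1) (star (symbolMul ψ hψ f)),
    Lp.coeFn_star (symbolMul ψ hψ f), coeFn_symbolMul hψ f] with t h₁ h₂ h₃
  rw [companion, h₁, h₂, Pi.star_apply, h₃, RCLike.star_def, map_mul, Complex.conj_ofReal]

theorem companion_mem_H2_iff :
    companion ψ hψ f ∈ H2 ↔ ∀ n : ℕ, 2 ≤ n → fourierCoeff (symbolMul ψ hψ f) n = 0 := by
  have hcoeff (n : ℤ) :
      fourierCoeff (companion ψ hψ f) (1 - n) = conj (fourierCoeff (symbolMul ψ hψ f) n) := by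
    rw [companion, fourierCoeff_mulC_fourier, fourierCoeff_star]
    congr 2
    ring
  refine ⟨fun h n hn => ?_, fun h n hn => ?_⟩
  · rw [← map_eq_zero (starRingEnd ℂ), ← hcoeff]
    exact h _ (by lia)
  · obtain ⟨k, hk⟩ : ∃ k : ℕ, n = 1 - (k : ℤ) := ⟨(1 - n).toNat, by lia⟩
    rw [hk, hcoeff, h k (by lia), map_zero]

theorem inner_mulC_fourier_symbolMul (n : ℤ) :
    inner ℂ (mulC (fourier n) f) (symbolMul ψ hψ f) =
      fourierCoeff (fun t => ((ψ t * ‖f t‖ ^ 2 : ℝ) : ℂ)) n := by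
  rw [L2.inner_def]
  refine integral_congr_ae ?_
  filter_upwards [coeFn_mulC (fourier n) f, coeFn_symbolMul hψ f] with t h₁ h₂
  rw [h₁, h₂, RCLike.inner_apply, map_mul, fourier_neg, smul_eq_mul, Complex.ofReal_mul,
    Complex.ofReal_pow, ← Complex.conj_mul']
  ring

theorem inner_symbolMul_self : inner ℂ f (symbolMul ψ hψ f) =
    fourierCoeff (fun t => ((ψ t * ‖f t‖ ^ 2 : ℝ) : ℂ)) 0 := by
  rw [← inner_mulC_fourier_symbolMul, show (fourier 0 : C(Torus, ℂ)) = 1 from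
    ContinuousMap.ext fun _ => fourier_zero, mulC_one]

end SymbolMultiplication

section OuterSolutions

theorem isOuterOnDisc_hFun (c : ℂ) : IsOuterOnDisc (hFun c) := by
  obtain ⟨F, hF, -, hFz⟩ := exists_isOuter_eq_exp (U := (1 / 2 : ℝ) • logTrig c) (B := ‖c‖) (by
    filter_upwards [Lp.coeFn_smul (1 / 2 : ℝ) (logTrig c), coeFn_logTrig c] with t h₁ h₂
    rw [h₁, Pi.smul_apply, h₂, smul_eq_mul]
    linarith [Real.log_le_self (abs_nonneg (trig c t)), abs_trig_le c t])
  refine ⟨F, hF, fun z hz => ?_⟩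
  rw [mem_ball_zero_iff] at hz
  rw [hFun_eq c hz, hFz z hz]

theorem isOuterOnDisc_gFun {φ : Torus → ℝ} {l : ℝ} {L : Lp ℝ 2 arc}
    (hL : L =ᵐ[arc] fun t => Real.log |φ t - l|) {b : ℝ} (hb : ∀ᵐ t ∂arc, b ≤ L t) :
    IsOuterOnDisc (gFun φ l) := by
  obtain ⟨F, hF, -, hFz⟩ := exists_isOuter_eq_exp (U := (-1 / 2 : ℝ) • L) (B := -1 / 2 * b) (by
    filter_upwards [Lp.coeFn_smul (-1 / 2 : ℝ) L, hb] with t h₁ h₂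
    rw [h₁, Pi.smul_apply, smul_eq_mul]
    linarith)
  refine ⟨F, hF, fun z hz => ?_⟩
  rw [mem_ball_zero_iff] at hz
  rw [gFun_eq hL hz, hFz z hz]

theorem exists_fourier_mul_trig_eq_mul_exp {c : ℂ} (hc : c ≠ 0) : ∃ a : ℂ, a ≠ 0 ∧
    ∀ᵐ t ∂arc, fourier 1 t * trig c t = a * Complex.exp (analyticCompletion (logTrig c) t) := by
  obtain ⟨E, hE, hEt, -⟩ := exists_isOuter_eq_exp (U := logTrig c) (B := 2 * ‖c‖) (by
    filter_upwards [coeFn_logTrig c] with t ht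
    rw [ht]
    exact (Real.log_le_self (abs_nonneg _)).trans (abs_trig_le c t))
  have hquad : (c • (fourierLp 2 2 : L2) + conj c • one : L2) =ᵐ[arc]
      fun t => fourier 1 t * trig c t := by
    filter_upwards [Lp.coeFn_add (c • (fourierLp 2 2 : L2)) (conj c • one),
      Lp.coeFn_smul c (fourierLp 2 2 : L2), Lp.coeFn_smul (conj c) one, coeFn_one,
      coeFn_fourierLp (T := 2 * Real.pi) 2 2] with t h₁ h₂ h₃ h₄ h₅
    have hz : (fourier 1 t : ℂ) * conj (fourier 1 t : ℂ) = 1 := by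
      rw [Complex.mul_conj', norm_fourier_apply, Complex.ofReal_one, one_pow]
    rw [h₁, Pi.add_apply, h₂, h₃, Pi.smul_apply, Pi.smul_apply, h₄, h₅, ofReal_trig, map_mul,
      smul_eq_mul, smul_eq_mul, show (2 : ℤ) = 1 + 1 from rfl, fourier_add]
    linear_combination (-conj c) * hz
  obtain ⟨a, ha, hpa⟩ := hE.eq_smul_of_norm_eq (isOuter_quadratic hc)
    (by
      filter_upwards [hEt] with t ht
      rw [ht]
      exact Complex.exp_ne_zero _)
    (by
      filter_upwards [hquad, hEt, norm_exp_analyticCompletion (logTrig c), coeFn_logTrig c,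
        trig_ne_zero hc] with t h₁ h₂ h₃ h₄ h₅
      rw [h₁, h₂, h₃, h₄, norm_mul, norm_fourier_apply, one_mul, Complex.norm_real,
        Real.norm_eq_abs, Real.exp_log (abs_pos.2 h₅)])
  refine ⟨a, norm_ne_zero_iff.1 (ha ▸ one_ne_zero), ?_⟩
  filter_upwards [hquad, hpa ▸ Lp.coeFn_smul a E, hEt] with t h₁ h₂ h₃
  rw [← h₁, h₂, Pi.smul_apply, h₃, smul_eq_mul]

theorem isOuter_companion {c : ℂ} (hc : c ≠ 0) {W : Lp ℝ 2 arc} {B : ℝ}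
    (hB : ∀ᵐ t ∂arc, (logTrig c - W : Lp ℝ 2 arc) t ≤ B) {f : L2}
    (hf : f =ᵐ[arc] fun t => Complex.exp (analyticCompletion W t)) {ψ : Torus → ℝ}
    (hψ : MemLp ψ ∞ arc) (hsol : ∀ᵐ t ∂arc, ψ t * ‖f t‖ ^ 2 = trig c t) :
    IsOuter (companion ψ hψ f) := by
  obtain ⟨Y, hY, hYt, -⟩ := exists_isOuter_eq_exp hB
  obtain ⟨a, ha, hpa⟩ := exists_fourier_mul_trig_eq_mul_exp hc
  suffices h : companion ψ hψ f = a • Y from h ▸ hY.smul ha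
  rw [map_sub] at hYt
  apply Lp.ext
  filter_upwards [coeFn_companion hψ f, Lp.coeFn_smul a Y, hYt, hf, hsol, hpa,
    Lp.coeFn_sub (analyticCompletion (logTrig c)) (analyticCompletion W)]
    with t h_comp h_smul hY hf hsol hpa h_sub
  rw [h_comp, h_smul, Pi.smul_apply, smul_eq_mul]
  refine mul_right_cancel₀ (hf ▸ Complex.exp_ne_zero _ : f t ≠ 0) ?_
  calc fourier 1 t * (ψ t * conj (f t)) * f t = fourier 1 t * trig c t := by
        rw [← hsol, Complex.ofReal_mul, Complex.ofReal_pow, ← Complex.conj_mul']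
        ring
    _ = a * Y t * f t := by
        rw [hpa, hY, hf, h_sub, Pi.sub_apply, mul_assoc, ← Complex.exp_add, sub_add_cancel]

theorem mul_exp_half_log_sub_sq {a b : ℝ} (hab : 0 < a * b) :
    a * Real.exp (1 / 2 * Real.log |b| + -1 / 2 * Real.log |a|) ^ 2 = b := by
  have ha : a ≠ 0 := left_ne_zero_of_mul hab.ne'
  have hb : b ≠ 0 := right_ne_zero_of_mul hab.ne'
  have hexp : Real.exp (1 / 2 * Real.log |b| + -1 / 2 * Real.log |a|) ^ 2 = |b / a| := by
    rw [← Real.exp_nat_mul, ← Real.exp_log (abs_pos.2 (div_ne_zero hb ha)), abs_div,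
      Real.log_div (abs_ne_zero.2 hb) (abs_ne_zero.2 ha)]
    congr 1
    push_cast
    ring
  have hdiv : 0 < b / a := div_pos_iff.2 ((mul_pos_iff.1 hab).imp And.symm And.symm)
  rw [hexp, abs_of_pos hdiv, mul_div_cancel₀ _ ha]

theorem exists_outer_solution {c : ℂ} (hc : c ≠ 0) {ψ : Torus → ℝ} (hψ : MemLp ψ ∞ arc)
    {L : Lp ℝ 2 arc} (hL : L =ᵐ[arc] fun t => Real.log |ψ t|) {b B : ℝ}
    (hb : ∀ᵐ t ∂arc, b ≤ L t ∧ L t ≤ B) (hpos : ∀ᵐ t ∂arc, 0 < ψ t * trig c t) :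
    ∃ f : L2, IsOuter f ∧ IsOuter (companion ψ hψ f) ∧
      (∀ᵐ t ∂arc, ψ t * ‖f t‖ ^ 2 = trig c t) ∧
      ∀ z, ‖z‖ < 1 → eval f z =
        Complex.exp (eval (analyticCompletion ((1 / 2 : ℝ) • logTrig c)) z) *
          Complex.exp (eval (analyticCompletion ((-1 / 2 : ℝ) • L)) z) := by
  set W : Lp ℝ 2 arc := (1 / 2 : ℝ) • logTrig c + (-1 / 2 : ℝ) • L with hW
  have hWt : W =ᵐ[arc] fun t => 1 / 2 * Real.log |trig c t| + -1 / 2 * L t := by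
    filter_upwards [Lp.coeFn_add ((1 / 2 : ℝ) • logTrig c) ((-1 / 2 : ℝ) • L),
      Lp.coeFn_smul (1 / 2 : ℝ) (logTrig c), Lp.coeFn_smul (-1 / 2 : ℝ) L, coeFn_logTrig c]
      with t h₁ h₂ h₃ h₄
    rw [h₁, Pi.add_apply, h₂, h₃, Pi.smul_apply, Pi.smul_apply, h₄, smul_eq_mul, smul_eq_mul]
  have htrig (t : Torus) : Real.log |trig c t| ≤ 2 * ‖c‖ :=
    (Real.log_le_self (abs_nonneg _)).trans (abs_trig_le c t)
  obtain ⟨f, hf, hft, hfz⟩ := exists_isOuter_eq_exp (U := W) (B := ‖c‖ + -1 / 2 * b) (by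
    filter_upwards [hWt, hb] with t h₁ h₂
    rw [h₁]
    linarith [htrig t])
  have hsol : ∀ᵐ t ∂arc, ψ t * ‖f t‖ ^ 2 = trig c t := by
    filter_upwards [hft, norm_exp_analyticCompletion W, hWt, hL, hpos] with t h₁ h₂ h₃ h₄ h₅
    rw [h₁, h₂, h₃, h₄, mul_exp_half_log_sub_sq h₅]
  refine ⟨f, hf, isOuter_companion (B := ‖c‖ + 1 / 2 * B) hc ?_ hft hψ hsol, hsol, fun z hz => ?_⟩
  · filter_upwards [Lp.coeFn_sub (logTrig c) W, coeFn_logTrig c, hWt, hb] with t h₁ h₂ h₃ h₄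
    rw [h₁, Pi.sub_apply, h₂, h₃]
    linarith [htrig t]
  · rw [hfz z hz, hW, map_add, eval_add _ _ hz, Complex.exp_add]

end OuterSolutions

section LinearPolynomials

theorem mem_linPoly {w : L2} : w ∈ linPoly ↔ ∃ a b : ℂ, a • one + b • chi = w :=
  Submodule.mem_span_pair

theorem inner_linPoly (a b : ℂ) (f : L2) :
    inner ℂ (a • one + b • chi) f = conj a * fourierCoeff f 0 + conj b * fourierCoeff f 1 := by
  rw [inner_add_left, inner_smul_left, inner_smul_left, one, chi, ← fourierCoeff_eq_inner,
    ← fourierCoeff_eq_inner]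

theorem inner_truncate {v : L2} (hv : v ∈ linPoly) (f : L2) :
    inner ℂ v (fourierCoeff f 0 • one + fourierCoeff f 1 • chi) = inner ℂ v f := by
  obtain ⟨a, b, rfl⟩ := mem_linPoly.1 hv
  rw [inner_linPoly, inner_linPoly]
  simp only [fourierCoeff_add, fourierCoeff_smul, one, chi, fourierCoeff_fourierLp]
  norm_num

theorem mem_H2V {W : Submodule ℂ L2} {f : L2} : f ∈ H2V W ↔ f ∈ H2 ∧ ∀ w ∈ W, inner ℂ w f = 0 := by
  rw [H2V, Submodule.mem_inf, Submodule.mem_orthogonal]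

theorem mulC_fourier_mem_H2V {W : Submodule ℂ L2} (hW : W ≤ linPoly) {k : L2} (hk : k ∈ H2)
    {n : ℕ} (hn : 2 ≤ n) : mulC (fourier n) k ∈ H2V W := by
  refine mem_H2V.2 ⟨mulC_fourier_mem_H2 n hk, fun w hw => ?_⟩
  obtain ⟨a, b, rfl⟩ := mem_linPoly.1 (hW hw)
  rw [inner_linPoly, fourierCoeff_mulC_fourier, fourierCoeff_mulC_fourier, hk _ (by lia),
    hk _ (by lia), mul_zero, mul_zero, add_zero]

/-- The vectors of `ℂ ⊕ ℂ z` orthogonal to `f`; when `f(0) ≠ 0` this is the space `𝒱` attached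
to `f`. -/
def linPolyPerp (f : L2) : Submodule ℂ L2 := linPoly ⊓ (Submodule.span ℂ {f})ᗮ

theorem linPolyPerp_le (f : L2) : linPolyPerp f ≤ linPoly := inf_le_left

theorem mem_linPolyPerp {f w : L2} : w ∈ linPolyPerp f ↔ w ∈ linPoly ∧ inner ℂ w f = 0 := by
  rw [linPolyPerp, Submodule.mem_inf, Submodule.mem_orthogonal_singleton_iff_inner_left]

instance finiteDimensional_linPoly : FiniteDimensional ℂ linPoly :=
  FiniteDimensional.span_of_finite ℂ (by simp)

theorem finrank_linPoly_le : Module.finrank ℂ linPoly ≤ 2 := by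
  classical
  have h := finrank_span_finset_le_card (R := ℂ) ({one, chi} : Finset L2)
  rw [Finset.coe_pair] at h
  exact h.trans Finset.card_le_two

theorem linPolyPerp_ne_linPoly {f : L2} (hf : fourierCoeff f 0 ≠ 0) : linPolyPerp f ≠ linPoly := by
  intro h
  have hone : one ∈ linPolyPerp f := h ▸ Submodule.subset_span (by simp)
  exact hf ((fourierCoeff_eq_inner f 0).trans (mem_linPolyPerp.1 hone).2)

theorem linPolyPerp_ne_bot {f : L2} (hf : fourierCoeff f 0 ≠ 0) : linPolyPerp f ≠ ⊥ := by
  refine (Submodule.ne_bot_iff _).2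
    ⟨(-conj (fourierCoeff f 1)) • one + conj (fourierCoeff f 0) • chi,
      mem_linPolyPerp.2 ⟨mem_linPoly.2 ⟨_, _, rfl⟩, ?_⟩, fun h => hf ?_⟩
  · rw [inner_linPoly, map_neg, Complex.conj_conj, Complex.conj_conj]
    ring
  · have hcoeff := congrArg (fun g : L2 => fourierCoeff g 1) h
    rw [fourierCoeff_add, fourierCoeff_smul, fourierCoeff_smul, one, chi, fourierCoeff_fourierLp,
      fourierCoeff_fourierLp, fourierCoeff_zero] at hcoeff
    simpa using hcoeff

theorem eq_linPolyPerp {f : L2} (hf : fourierCoeff f 0 ≠ 0) {W : Submodule ℂ L2} (hW : W ≤ linPoly)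
    (hW₀ : W ≠ ⊥) (hfW : ∀ w ∈ W, inner ℂ w f = 0) : W = linPolyPerp f := by
  have hle : W ≤ linPolyPerp f := fun w hw => mem_linPolyPerp.2 ⟨hW hw, hfW w hw⟩
  have hlt : linPolyPerp f < linPoly := (linPolyPerp_le f).lt_of_ne (linPolyPerp_ne_linPoly hf)
  have : FiniteDimensional ℂ (linPolyPerp f) := Submodule.finiteDimensional_of_le hlt.le
  have : FiniteDimensional ℂ W := Submodule.finiteDimensional_of_le hW
  have hdim := (Submodule.finrank_lt_finrank_of_lt hlt).trans_le finrank_linPoly_le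
  have hpos : Module.finrank ℂ W ≠ 0 := fun h => hW₀ (Submodule.finrank_eq_zero.1 h)
  exact Submodule.eq_of_le_of_finrank_le hle (by lia)

theorem mem_H2V_iff_eq_linPolyPerp {f : L2} (hfH : f ∈ H2) (hf : fourierCoeff f 0 ≠ 0)
    {W : Submodule ℂ L2} (hW : W ≤ linPoly) (hW₀ : W ≠ ⊥) : f ∈ H2V W ↔ W = linPolyPerp f := by
  refine ⟨fun h => eq_linPolyPerp hf hW hW₀ (mem_H2V.1 h).2, ?_⟩
  rintro rfl
  exact mem_H2V.2 ⟨hfH, fun w hw => (mem_linPolyPerp.1 hw).2⟩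

end LinearPolynomials

section ToeplitzKernel

variable {ψ : Torus → ℝ} (hψ : MemLp ψ ∞ arc)

theorem toeplitz_sub_const {φ : Torus → ℝ} (hφ : MemLp φ ∞ arc) {l : ℝ}
    (hl : MemLp (fun t => φ t - l) ∞ arc) (W : Submodule ℂ L2) (f : H2V W) :
    toeplitz (fun t => φ t - l) hl W f = toeplitz φ hφ W f - (l : ℂ) • f := by
  have hmul : symbolMul (fun t => φ t - l) hl f =
      symbolMul φ hφ f - (l : ℂ) • (f : L2) := by
    apply Lp.ext
    filter_upwards [coeFn_symbolMul hl f, coeFn_symbolMul hφ f,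
      Lp.coeFn_sub (symbolMul φ hφ f) ((l : ℂ) • (f : L2)), Lp.coeFn_smul (l : ℂ) (f : L2)]
      with t h₁ h₂ h₃ h₄
    rw [h₁, h₃, Pi.sub_apply, h₂, h₄, Pi.smul_apply, smul_eq_mul, Complex.ofReal_sub,
      sub_mul]
  calc (H2V W).orthogonalProjectionOnto (symbolMul _ hl f)
    _ = (H2V W).orthogonalProjectionOnto (symbolMul φ hφ f) - (l : ℂ) • f := by
        rw [hmul, map_sub, map_smul, Submodule.orthogonalProjectionOnto_mem_subspace_eq_self]

theorem toeplitz_eq_zero_iff {W : Submodule ℂ L2} {f : H2V W} :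
    toeplitz ψ hψ W f = 0 ↔ ∀ k ∈ H2V W, inner ℂ k (symbolMul ψ hψ f) = 0 := by
  rw [← Submodule.mem_orthogonal, ← Submodule.orthogonalProjectionOnto_eq_zero_iff]
  rfl

theorem starProjection_H2_symbolMul {f : L2} (hf : companion ψ hψ f ∈ H2) :
    H2.starProjection (symbolMul ψ hψ f) =
      fourierCoeff (symbolMul ψ hψ f) 0 • one + fourierCoeff (symbolMul ψ hψ f) 1 • chi := by
  refine ext_fourierCoeff_of_mem_H2 (Submodule.starProjection_apply_mem _ _)
    (H2.add_mem (H2.smul_mem _ (fourierLp_mem_H2 0)) (H2.smul_mem _ (fourierLp_mem_H2 1)))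
    fun n => ?_
  have hproj : fourierCoeff (H2.starProjection (symbolMul ψ hψ f)) n =
      fourierCoeff (symbolMul ψ hψ f) n := by
    rw [fourierCoeff_eq_inner, fourierCoeff_eq_inner,
      ← Submodule.inner_starProjection_left_eq_right,
      Submodule.starProjection_eq_self_iff.2 (fourierLp_mem_H2 n)]
  rw [hproj, fourierCoeff_add, fourierCoeff_smul, fourierCoeff_smul, one, chi,
    fourierCoeff_fourierLp, fourierCoeff_fourierLp]
  match n with
  | 0 => simp
  | 1 => simp
  | n + 2 =>
    rw [(companion_mem_H2_iff hψ f).1 hf (n + 2) (by lia), if_neg (by lia), if_neg (by lia),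
      mul_zero, mul_zero, add_zero]

theorem toeplitz_linPolyPerp_eq_zero {f : L2} (hfV : f ∈ H2V (linPolyPerp f))
    (hf : companion ψ hψ f ∈ H2) {c : ℂ} (hsol : ∀ᵐ t ∂arc, ψ t * ‖f t‖ ^ 2 = trig c t) :
    toeplitz ψ hψ (linPolyPerp f) ⟨f, hfV⟩ = 0 := by
  have hinner {k : L2} (hk : k ∈ H2) : inner ℂ k (H2.starProjection (symbolMul ψ hψ f)) =
      inner ℂ k (symbolMul ψ hψ f) := by
    rw [← Submodule.inner_starProjection_left_eq_right, Submodule.starProjection_eq_self_iff.2 hk]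
  have horth : inner ℂ f (symbolMul ψ hψ f) = 0 := by
    rw [inner_symbolMul_self, fourierCoeff_congr_ae (hsol.mono fun t ht => by rw [ht]),
      fourierCoeff_trig, if_neg (by norm_num), if_neg (by norm_num), add_zero]
  have hmem : H2.starProjection (symbolMul ψ hψ f) ∈ linPolyPerp f :=
    mem_linPolyPerp.2 ⟨mem_linPoly.2 ⟨_, _, (starProjection_H2_symbolMul hψ hf).symm⟩,
      inner_eq_zero_symm.1 ((hinner (mem_H2V.1 hfV).1).trans horth)⟩
  refine (toeplitz_eq_zero_iff hψ).2 fun k hk => ?_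
  rw [← hinner (mem_H2V.1 hk).1]
  exact inner_eq_zero_symm.1 ((mem_H2V.1 hk).2 _ hmem)

theorem companion_mem_H2_of_toeplitz_eq_zero {W : Submodule ℂ L2} (hW : W ≤ linPoly) {f : H2V W}
    (hf : toeplitz ψ hψ W f = 0) : companion ψ hψ f ∈ H2 := by
  refine (companion_mem_H2_iff hψ f).2 fun n hn => ?_
  rw [fourierCoeff_eq_inner, ← mulC_fourier_one]
  exact (toeplitz_eq_zero_iff hψ).1 hf _ (mulC_fourier_mem_H2V hW one_mem_H2 hn)

theorem mul_norm_sq_eq_trig_of_toeplitz_eq_zero {W : Submodule ℂ L2} (hW : W ≤ linPoly)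
    {f : H2V W} (hf : toeplitz ψ hψ W f = 0) :
    ∀ᵐ t ∂arc, ψ t * ‖(f : L2) t‖ ^ 2 =
      trig (inner ℂ (mulC (fourier 1) (f : L2)) (symbolMul ψ hψ f)) t := by
  rw [toeplitz_eq_zero_iff] at hf
  rw [inner_mulC_fourier_symbolMul]
  refine ae_eq_trig_of_fourierCoeff_eq_zero (integrable_mul_norm_sq hψ f) ?_ fun n hn => ?_
  · rw [← inner_symbolMul_self hψ]
    exact hf f f.2
  · rw [← inner_mulC_fourier_symbolMul hψ]
    exact hf _ (mulC_fourier_mem_H2V hW (mem_H2V.1 f.2).1 hn)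

theorem eq_zero_of_toeplitz_bot_eq_zero (hψ₀ : ∀ᵐ t ∂arc, ψ t ≠ 0) {f : H2V ⊥}
    (hf : toeplitz ψ hψ ⊥ f = 0) : f = 0 := by
  have hshift : inner ℂ (mulC (fourier 1) (f : L2)) (symbolMul ψ hψ f) = 0 :=
    (toeplitz_eq_zero_iff hψ).1 hf _ (mem_H2V.2 ⟨mulC_fourier_mem_H2 1 (mem_H2V.1 f.2).1, by simp⟩)
  apply Subtype.ext
  apply Lp.ext
  filter_upwards [mul_norm_sq_eq_trig_of_toeplitz_eq_zero hψ bot_le hf, hψ₀, Lp.coeFn_zero ℂ 2 arc]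
    with t h₁ h₂ h₃
  rw [hshift] at h₁
  rw [Submodule.coe_zero, h₃]
  simpa [trig, h₂] using h₁

end ToeplitzKernel

section Uniqueness

theorem ne_zero_of_mul_norm_sq_eq_trig {c : ℂ} (hc : c ≠ 0) {ψ : Torus → ℝ} {f : L2}
    (hf : ∀ᵐ t ∂arc, ψ t * ‖f t‖ ^ 2 = trig c t) : ∀ᵐ t ∂arc, f t ≠ 0 := by
  filter_upwards [hf, trig_ne_zero hc] with t h₁ h₂ h₀
  rw [h₀, norm_zero, zero_pow two_ne_zero, mul_zero] at h₁
  exact h₂ h₁.symm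

theorem IsOuter.eq_smul_of_mul_norm_sq_eq_trig {c : ℂ} (hc : c ≠ 0) {ψ : Torus → ℝ} {f g : L2}
    (hf : IsOuter f) (hg : IsOuter g) (hfsol : ∀ᵐ t ∂arc, ψ t * ‖f t‖ ^ 2 = trig c t)
    (hgsol : ∀ᵐ t ∂arc, ψ t * ‖g t‖ ^ 2 = trig c t) : ∃ a : ℂ, ‖a‖ = 1 ∧ g = a • f := by
  refine hf.eq_smul_of_norm_eq hg (ne_zero_of_mul_norm_sq_eq_trig hc hfsol) ?_
  filter_upwards [hfsol, hgsol, trig_ne_zero hc] with t h₁ h₂ h₃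
  have hψ : ψ t ≠ 0 := left_ne_zero_of_mul (h₁.trans_ne h₃)
  exact (sq_eq_sq₀ (norm_nonneg _) (norm_nonneg _)).1 (mul_left_cancel₀ hψ (h₂.trans h₁.symm))

theorem exists_norm_eq_mul_of_mul_norm_sq_eq_trig {c d : ℂ} (hc : c ≠ 0) {ψ : Torus → ℝ}
    {f g : L2} (hf : ∀ᵐ t ∂arc, ψ t * ‖f t‖ ^ 2 = trig c t)
    (hg : ∀ᵐ t ∂arc, ψ t * ‖g t‖ ^ 2 = trig d t) : ∃ r : ℝ, ∀ᵐ t ∂arc, ‖g t‖ = r * ‖f t‖ := by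
  obtain ⟨r, hr, rfl⟩ := exists_nonneg_eq_mul_of_trig_mul_nonneg (d := d) hc (by
    filter_upwards [hf, hg] with t h₁ h₂
    rw [← h₁, ← h₂, mul_mul_mul_comm]
    exact mul_nonneg (mul_self_nonneg _) (by positivity))
  refine ⟨√r, ?_⟩
  filter_upwards [hf, hg, trig_ne_zero hc] with t h₁ h₂ h₃
  have hψ : ψ t ≠ 0 := left_ne_zero_of_mul (h₁.trans_ne h₃)
  rw [trig_ofReal_mul, ← h₁, mul_left_comm] at h₂
  rw [← sq_eq_sq₀ (norm_nonneg _) (by positivity), mul_pow, Real.sq_sqrt hr,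
    mul_left_cancel₀ hψ h₂]

theorem companion_mulL {ψ : Torus → ℝ} (hψ : MemLp ψ ∞ arc) (u : Lp ℂ ∞ arc) (f : L2) :
    companion ψ hψ (mulL u f) = mulL (star u) (companion ψ hψ f) := by
  apply Lp.ext
  filter_upwards [coeFn_companion hψ (mulL u f), coeFn_mulL (star u) (companion ψ hψ f),
    coeFn_companion hψ f, coeFn_mulL u f, Lp.coeFn_star u] with t h₁ h₂ h₃ h₄ h₅
  rw [h₁, h₂, h₃, h₄, h₅, Pi.star_apply, RCLike.star_def, map_mul]
  ring

theorem IsOuter.exists_eq_smul_of_companion_mem_H2 {ψ : Torus → ℝ} (hψ : MemLp ψ ∞ arc) {f g : L2}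
    (hf : IsOuter f) (hf' : IsOuter (companion ψ hψ f)) (hf₀ : ∀ᵐ t ∂arc, f t ≠ 0) {r : ℝ}
    (hfg : ∀ᵐ t ∂arc, ‖g t‖ ≤ r * ‖f t‖) (hg : g ∈ H2) (hg' : companion ψ hψ g ∈ H2) :
    ∃ a : ℂ, g = a • f := by
  obtain ⟨u, rfl⟩ := exists_mulL_eq hf₀ hfg
  rw [companion_mulL] at hg'
  obtain ⟨a, ha⟩ := ae_eq_const_of_mulL_mem_H2 hf hf' hg hg'
  exact ⟨a, mulL_eq_smul ha f⟩

theorem IsOuter.exists_eq_smul_of_toeplitz_eq_zero {c : ℂ} (hc : c ≠ 0) {ψ : Torus → ℝ}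
    (hψ : MemLp ψ ∞ arc) {f : L2} (hf : IsOuter f) (hf' : IsOuter (companion ψ hψ f))
    (hsol : ∀ᵐ t ∂arc, ψ t * ‖f t‖ ^ 2 = trig c t) {W : Submodule ℂ L2} (hW : W ≤ linPoly)
    {g : H2V W} (hg : toeplitz ψ hψ W g = 0) : ∃ a : ℂ, (g : L2) = a • f := by
  obtain ⟨r, hr⟩ := exists_norm_eq_mul_of_mul_norm_sq_eq_trig hc hsol
    (mul_norm_sq_eq_trig_of_toeplitz_eq_zero hψ hW hg)
  exact hf.exists_eq_smul_of_companion_mem_H2 hψ hf' (ne_zero_of_mul_norm_sq_eq_trig hc hsol)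
    (hr.mono fun _ => le_of_eq) (mem_H2V.1 g.2).1 (companion_mem_H2_of_toeplitz_eq_zero hψ hW hg)

theorem IsOuter.eq_linPolyPerp_of_toeplitz_eq_zero {c : ℂ} (hc : c ≠ 0) {ψ : Torus → ℝ}
    (hψ : MemLp ψ ∞ arc) {f : L2} (hf : IsOuter f) (hf' : IsOuter (companion ψ hψ f))
    (hf₀ : fourierCoeff f 0 ≠ 0) (hsol : ∀ᵐ t ∂arc, ψ t * ‖f t‖ ^ 2 = trig c t)
    {W : Submodule ℂ L2} (hW : W ≤ linPoly) {g : H2V W} (hg₀ : g ≠ 0)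
    (hg : toeplitz ψ hψ W g = 0) : W = linPolyPerp f ∧ ∃ a : ℂ, a ≠ 0 ∧ (g : L2) = a • f := by
  obtain ⟨a, hga⟩ := hf.exists_eq_smul_of_toeplitz_eq_zero hc hψ hf' hsol hW hg
  have ha : a ≠ 0 := by
    rintro rfl
    exact hg₀ (Subtype.ext (hga.trans (zero_smul ℂ f)))
  have hfW : f ∈ H2V W := by
    have := (H2V W).smul_mem a⁻¹ g.2
    rwa [hga, inv_smul_smul₀ ha] at this
  have hψ₀ : ∀ᵐ t ∂arc, ψ t ≠ 0 := by
    filter_upwards [hsol, trig_ne_zero hc] with t h₁ h₂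
    exact left_ne_zero_of_mul (h₁.trans_ne h₂)
  have hW₀ : W ≠ ⊥ := by
    rintro rfl
    exact hg₀ (eq_zero_of_toeplitz_bot_eq_zero hψ hψ₀ hg)
  exact ⟨(mem_H2V_iff_eq_linPolyPerp hf.mem_H2 hf₀ hW hW₀).1 hfW, a, ha, hga⟩

theorem IsOuterOnDisc.hasDerivAt_zero {F : ℂ → ℂ} (hF : IsOuterOnDisc F) :
    HasDerivAt F (deriv F 0) 0 := by
  obtain ⟨f, -, hf⟩ := hF
  exact ((hasDerivAt_eval_zero f).congr_of_eventuallyEq (Filter.eventually_of_mem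
    (Metric.ball_mem_nhds _ one_pos) hf)).differentiableAt.hasDerivAt

theorem fourierCoeff_one_of_eval_eq_mul {F G : ℂ → ℂ} (hF : IsOuterOnDisc F)
    (hG : IsOuterOnDisc G) {f : L2} (hf : ∀ z ∈ Metric.ball (0 : ℂ) 1, eval f z = F z * G z) :
    fourierCoeff f 1 = F 0 * deriv G 0 + deriv F 0 * G 0 := by
  have h := (hF.hasDerivAt_zero.mul hG.hasDerivAt_zero).congr_of_eventuallyEq
    (Filter.eventually_of_mem (Metric.ball_mem_nhds _ one_pos) hf)
  rw [(hasDerivAt_eval_zero f).unique h, add_comm]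

end Uniqueness

theorem corollary3p4_general (φ : Torus → ℝ) (hφ : MemLp φ ∞ arc) (c : ℂ) (hc : c ≠ 0) (l : ℝ)
    (hl : l ∈ Set.Ioo (essSup φ (arc.restrict {t | trig c t < 0}))
      (essInf φ (arc.restrict {t | 0 < trig c t}))) :
    IsOuterOnDisc (hFun c) ∧ IsOuterOnDisc (gFun φ l) ∧
    hFun c 0 ≠ 0 ∧ gFun φ l 0 ≠ 0 ∧
    ∃ f : L2, IsOuter f ∧
      (∀ᵐ t ∂arc, (φ t - l) * ‖f t‖ ^ 2 = trig c t) ∧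
      (∀ z ∈ Metric.ball (0 : ℂ) 1, eval f z = hFun c z * gFun φ l z) ∧
      (∀ f' : L2, IsOuter f' →
        (∀ᵐ t ∂arc, (φ t - l) * ‖f' t‖ ^ 2 = trig c t) →
        ∃ a : ℂ, ‖a‖ = 1 ∧ f' = a • f) ∧
      ∃ V : Submodule ℂ L2,
        V ≤ linPoly ∧ V ≠ ⊥ ∧ V ≠ linPoly ∧
        (∀ v ∈ V, inner ℂ v
          ((hFun c 0 * gFun φ l 0) • one +
            (hFun c 0 * deriv (gFun φ l) 0 + deriv (hFun c) 0 * gFun φ l 0) • chi) = 0) ∧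
        (∀ W : Submodule ℂ L2, W ≤ linPoly → W ≠ ⊥ → (f ∈ H2V W ↔ W = V)) ∧
        (∀ hf : f ∈ H2V V, toeplitz φ hφ V ⟨f, hf⟩ = (l : ℂ) • ⟨f, hf⟩) ∧
        (∀ W : Submodule ℂ L2, W ≤ linPoly → ∀ f' : H2V W, f' ≠ 0 →
          toeplitz φ hφ W f' = (l : ℂ) • f' → W = V ∧ ∃ a : ℂ, a ≠ 0 ∧ (f' : L2) = a • f) := by
  obtain ⟨δ, C, hδ, hbound⟩ :=
    exists_bounds_sub_mul_pos hφ (continuous_trig c).measurable (trig_ne_zero hc) hl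
  have hψ : MemLp (fun t => φ t - l) ∞ arc := hφ.sub (memLp_const l)
  obtain ⟨L, hL, hLb⟩ :=
    exists_Lp_eq_log_abs hψ.1.aemeasurable hδ (hbound.mono fun t h => ⟨h.1, h.2.1⟩) 2
  obtain ⟨f, hf, hf', hsol, hfac⟩ :=
    exists_outer_solution hc hψ hL hLb (hbound.mono fun t h => h.2.2)
  replace hfac : ∀ z ∈ Metric.ball (0 : ℂ) 1, eval f z = hFun c z * gFun φ l z := fun z hz => by
    rw [mem_ball_zero_iff] at hz
    rw [hfac z hz, hFun_eq c hz, gFun_eq hL hz]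
  have hh := isOuterOnDisc_hFun c
  have hg := isOuterOnDisc_gFun hL (hLb.mono fun t h => h.1)
  have hcoeff₀ : fourierCoeff f 0 = hFun c 0 * gFun φ l 0 := by
    rw [← eval_zero, hfac 0 (Metric.mem_ball_self one_pos)]
  have hne : fourierCoeff f 0 ≠ 0 :=
    hcoeff₀.trans_ne (mul_ne_zero (Complex.exp_ne_zero _) (Complex.exp_ne_zero _))
  refine ⟨hh, hg, Complex.exp_ne_zero _, Complex.exp_ne_zero _, f, hf, hsol, hfac,
    fun g hg hgsol => hf.eq_smul_of_mul_norm_sq_eq_trig hc hg hsol hgsol, linPolyPerp f,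
    linPolyPerp_le f, linPolyPerp_ne_bot hne, linPolyPerp_ne_linPoly hne, fun v hv => ?_,
    fun W => mem_H2V_iff_eq_linPolyPerp hf.mem_H2 hne, fun hfV => ?_, fun W hW g hg₀ hg => ?_⟩
  · rw [← hcoeff₀, ← fourierCoeff_one_of_eval_eq_mul hh hg hfac,
      inner_truncate (linPolyPerp_le f hv), (mem_linPolyPerp.1 hv).2]
  · rw [← sub_eq_zero, ← toeplitz_sub_const hφ hψ]
    exact toeplitz_linPolyPerp_eq_zero hψ hfV hf'.mem_H2 hsol
  · rw [← sub_eq_zero, ← toeplitz_sub_const hφ hψ] at hg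
    exact hf.eq_linPolyPerp_of_toeplitz_eq_zero hc hψ hf' hne hsol hW hg₀ hg

end NeilToeplitz

end

open NeilToeplitz in
theorem corollary3p4
    (φ : NeilToeplitz.Torus → ℝ) (hφ : MemLp φ ∞ NeilToeplitz.arc)
    (c : ℂ) (hc : c ≠ 0) (m M : ℝ)
    (hm : essSup φ (NeilToeplitz.arc.restrict {t | NeilToeplitz.trig c t < 0}) = m)
    (hm0 : m < 0) (hM0 : 0 < M)
    (hM : essInf φ (NeilToeplitz.arc.restrict {t | 0 < NeilToeplitz.trig c t}) = M)
    (l : ℝ) (hl : l ∈ Set.Ioo m M) :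
    -- `h_c` and `g_l` are outer, with nonzero values at `0`
    NeilToeplitz.IsOuterOnDisc (NeilToeplitz.hFun c) ∧
    NeilToeplitz.IsOuterOnDisc (NeilToeplitz.gFun φ l) ∧
    NeilToeplitz.hFun c 0 ≠ 0 ∧ NeilToeplitz.gFun φ l 0 ≠ 0 ∧
    -- the essentially unique outer function `f = f_l`, and its factorization
    ∃ f : NeilToeplitz.L2, NeilToeplitz.IsOuter f ∧
      (∀ᵐ t ∂NeilToeplitz.arc, (φ t - l) * ‖f t‖ ^ 2 = NeilToeplitz.trig c t) ∧
      (∀ z ∈ Metric.ball (0 : ℂ) 1,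
        NeilToeplitz.eval f z = NeilToeplitz.hFun c z * NeilToeplitz.gFun φ l z) ∧
      (∀ f' : NeilToeplitz.L2, NeilToeplitz.IsOuter f' →
        (∀ᵐ t ∂NeilToeplitz.arc, (φ t - l) * ‖f' t‖ ^ 2 = NeilToeplitz.trig c t) →
        ∃ a : ℂ, ‖a‖ = 1 ∧ f' = a • f) ∧
      -- the nontrivial space `V`, orthogonal to the first order part of `h_c g_l`
      ∃ V : Submodule ℂ NeilToeplitz.L2,
        V ≤ NeilToeplitz.linPoly ∧ V ≠ ⊥ ∧ V ≠ NeilToeplitz.linPoly ∧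
        (∀ v ∈ V, inner ℂ v
          ((NeilToeplitz.hFun c 0 * NeilToeplitz.gFun φ l 0) • NeilToeplitz.one +
            (NeilToeplitz.hFun c 0 * deriv (NeilToeplitz.gFun φ l) 0 +
              deriv (NeilToeplitz.hFun c) 0 * NeilToeplitz.gFun φ l 0) •
                NeilToeplitz.chi) = 0) ∧
        -- `f` belongs to `H²_W`, for nonzero `W`, exactly when `W = V`
        (∀ W : Submodule ℂ NeilToeplitz.L2, W ≤ NeilToeplitz.linPoly → W ≠ ⊥ →
          (f ∈ NeilToeplitz.H2V W ↔ W = V)) ∧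
        -- `f` is an eigenvector of the Toeplitz operator on `H²_V` with eigenvalue `l`
        (∀ hf : f ∈ NeilToeplitz.H2V V,
          NeilToeplitz.toeplitz φ hφ V ⟨f, hf⟩ = (l : ℂ) • ⟨f, hf⟩) ∧
        -- every eigenvector for `l`, on any of the spaces, is a multiple of `f`, and lives on `V`
        (∀ W : Submodule ℂ NeilToeplitz.L2, W ≤ NeilToeplitz.linPoly →
          ∀ f' : NeilToeplitz.H2V W, f' ≠ 0 →
            NeilToeplitz.toeplitz φ hφ W f' = (l : ℂ) • f' →
            W = V ∧ ∃ a : ℂ, a ≠ 0 ∧ (f' : NeilToeplitz.L2) = a • f) := by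
  exact corollary3p4_general φ hφ c hc l (by rwa [hm, hM])
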